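/- Let $\mathbb{H}=\{x+iy\in\mathbb{C}: y>0\}$ be the hyperbolic plane with the metric $\mathrm{d}s=\sqrt{\mathrm{d}x^2+\mathrm{d}y^2}/y$ and circle at infinity $\partial\mathbb{H}=\mathbb{R}\cup\{\infty\}$. Let $\mathcal{G}_{\mathbb{H}}=((\partial\mathbb{H}\times\partial\mathbb{H})\setminus\Delta)/\mathbb{Z}_2$ be the space of complete unoriented geodesics of $\mathbb{H}$, each identified with the unordered pair of its endpoints, and let $\mu$ be the Liouville measure on $\mathcal{G}_{\mathbb{H}}$, given in terms of the endpoints $u,v$ by $\mathrm{d}\mu=\mathrm{d}u\,\mathrm{d}v/|u-v|^2$ (the geodesics with endpoint $\infty$ form a null set). Let $D\subset\mathbb{H}$ be a compact, geodesically convex set with nonempty interior, and let $\mathcal{G}_D\subset\mathcal{G}_{\mathbb{H}}$ be the set of geodesics that intersect $D$. If the boundary $\partial D$ is a simple closed geodesic polygon or a simple closed (regular) $C^1$ curve, then $$\mu(\mathcal{G}_D)=\tfrac12 L(\partial D),$$ where $L(\partial D)$ is the hyperbolic length of $\partial D$: in the polygonal case the sum of the hyperbolic lengths of the edges, and in the $C^1$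 case $\int_0^T |c'(t)|/\operatorname{Im}c(t)\,\mathrm{d}t$ for any regular $C^1$ parametrization $c$ of $\partial D$ that has period $T$ and is injective on $[0,T)$. -/

import Mathlib

noncomputable section

namespace HypCrofton

open MeasureTheory Set
open scoped UpperHalfPlane OnePoint

/-! ### Geodesics of the hyperbolic plane

The hyperbolic plane is the upper half plane `ℍ` with Mathlib's hyperbolic metric, and its circle at
infinity is `OnePoint ℝ`. -/

/-- Ordered pairs of distinct points at infinity. -/
abbrev EndpointPair : Type := {p : OnePoint ℝ × OnePoint ℝ // p.1 ≠ p.2}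

/-- The space of complete, unoriented geodesics: unordered pairs of distinct points at infinity. -/
def Geodesic : Type := {e : Sym2 (OnePoint ℝ) // ¬ e.IsDiag}

/-- The geodesic with two given distinct endpoints. -/
def Geodesic.ofEndpoints (p : EndpointPair) : Geodesic :=
  ⟨s(p.1.1, p.1.2), fun h => p.2 (Sym2.mk_isDiag_iff.mp h)⟩

/-- The quotient topology: geodesics are ordered pairs of endpoints modulo the exchange. -/
instance : TopologicalSpace Geodesic := .coinduced Geodesic.ofEndpoints inferInstance

instance : MeasurableSpace Geodesic := borel Geodesic

instance : BorelSpace Geodesic := ⟨rfl⟩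

/-- The set of points of `ℍ` on the geodesic with endpoints `a`, `b`: a vertical half-line if one
endpoint is `∞`, the half-circle with diameter `[u, v]` if both endpoints are real. -/
def lineBetween : OnePoint ℝ → OnePoint ℝ → Set ℍ
  | ∞, ∞ => ∅
  | ∞, OnePoint.some v => {z | z.re = v}
  | OnePoint.some u, ∞ => {z | z.re = u}
  | OnePoint.some u, OnePoint.some v => {z | dist (z : ℂ) (((u + v) / 2 : ℝ) : ℂ) = |u - v| / 2}

theorem lineBetween_comm (a b : OnePoint ℝ) : lineBetween a b = lineBetween b a := by
  induction a using OnePoint.rec <;> induction b using OnePoint.rec <;>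
    simp only [lineBetween, add_comm, abs_sub_comm]

/-- The points of a geodesic. -/
def Geodesic.points (γ : Geodesic) : Set ℍ :=
  Sym2.lift ⟨lineBetween, lineBetween_comm⟩ γ.1

/-- The set of geodesics that meet `D`. -/
def geodesicsMeeting (D : Set ℍ) : Set Geodesic := {γ | (γ.points ∩ D).Nonempty}

/-! ### The Liouville measure -/

/-- Pairs of real numbers `u < v`; they parametrize the geodesics without endpoint `∞`, each once. -/
abbrev RealPair : Type := {p : ℝ × ℝ // p.1 < p.2}

/-- The geodesic with real endpoints `u < v`. -/
def Geodesic.ofReal (p : RealPair) : Geodesic :=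
  .ofEndpoints ⟨((p.1.1 : OnePoint ℝ), (p.1.2 : OnePoint ℝ)),
    fun h => p.2.ne (OnePoint.coe_injective h)⟩

theorem Geodesic.continuous_ofReal : Continuous Geodesic.ofReal := by
  have h : Continuous Geodesic.ofEndpoints := continuous_coinduced_rng
  refine h.comp (Continuous.subtype_mk ?_ _)
  exact (OnePoint.continuous_coe.comp (continuous_fst.comp continuous_subtype_val)).prodMk
    (OnePoint.continuous_coe.comp (continuous_snd.comp continuous_subtype_val))

/-- The Liouville measure: `du dv / |u - v| ^ 2` on the space of unoriented geodesics (the geodesics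
with endpoint `∞` form a null set). -/
def liouville : Measure Geodesic :=
  (((volume : Measure (ℝ × ℝ)).withDensity
    fun p => ENNReal.ofReal (1 / |p.1 - p.2| ^ 2)).comap (Subtype.val : RealPair → ℝ × ℝ)).map
      Geodesic.ofReal

/-! ### Convex domains and their boundaries -/

/-- The geodesic segment with endpoints `x`, `y`. -/
def geodesicSegment (x y : ℍ) : Set ℍ := {z | dist x z + dist z y = dist x y}

/-- Geodesic convexity. -/
def IsGeodesicallyConvex (D : Set ℍ) : Prop :=
  ∀ x ∈ D, ∀ y ∈ D, geodesicSegment x y ⊆ D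

/-- A compact convex domain: a compact, geodesically convex set with nonempty interior. -/
structure IsCompactConvexDomain (D : Set ℍ) : Prop where
  isCompact : IsCompact D
  convex : IsGeodesicallyConvex D
  interior_nonempty : (interior D).Nonempty

/-- `C` is the simple closed geodesic polygon with cyclically ordered vertices `p 0, …, p (n - 1)`;
its edges are the segments from `p i` to `p (i + 1)`, where `i + 1` is taken modulo `n`. -/
structure IsSimplePolygon {n : ℕ} [NeZero n] (p : Fin n → ℍ) (C : Set ℍ) : Prop where
  three_le : 3 ≤ n
  edge_ne : ∀ i, p i ≠ p (i + 1)
  /-- Distinct edges meet at most in a common vertex of consecutive edges. -/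
  simple : Pairwise fun i j =>
    Disjoint (geodesicSegment (p i) (p (i + 1)) \ {p (i + 1)})
      (geodesicSegment (p j) (p (j + 1)) \ {p (j + 1)})
  iUnion_eq : ⋃ i, geodesicSegment (p i) (p (i + 1)) = C

/-- The sum of the hyperbolic lengths of the edges of a polygon. -/
def polygonLength {n : ℕ} [NeZero n] (p : Fin n → ℍ) : ℝ := ∑ i, dist (p i) (p (i + 1))

/-- `C` is a simple closed `C^1` curve, and `c` is a regular `C^1` parametrization of it with
period `T`. -/
structure IsSimpleClosedC1Curve (T : ℝ) (c : ℝ → ℍ) (C : Set ℍ) : Prop where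
  pos : 0 < T
  periodic : Function.Periodic c T
  contDiff : ContDiff ℝ 1 fun t => (c t : ℂ)
  regular : ∀ t, deriv (fun s => (c s : ℂ)) t ≠ 0
  injOn : InjOn c (Ico 0 T)
  image_eq : c '' Ico 0 T = C

/-- The hyperbolic length `∫ √(dx² + dy²) / y` of a curve over `[0, T]`. -/
def curveLength (T : ℝ) (c : ℝ → ℍ) : ℝ :=
  ∫ t in (0 : ℝ)..T, ‖deriv (fun s => (c s : ℂ)) t‖ / (c t).im

end HypCrofton

end

/-! Disintegrate the measure over one endpoint `u`. The geodesics ending at `u` are the level sets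
of `pencil u z = Re (-1 / (z - u))`, the one with other endpoint `v` having level `-1 / (v - u)`.
Since `d(-1 / (v - u)) = dv / (v - u)^2`, the geodesics from `u` that meet `D` have measure equal to
the oscillation of `pencil u` on `D`. Integrating over `u` counts every geodesic twice, so `2 μ = ∫
osc_D (pencil u) du` (`two_mul_liouville_eq_lintegral`).

In the projective model geodesics are straight lines, so `D` becomes convex, and a line through its
interior meets the boundary at most twice (`not_three_on_level`). Hence along the boundary curve `c`
the function `pencil u` takes each value strictly between its extremes at most twice, and its total
variation is twice its oscillation (`integral_abs_deriv_eq`). This gives `4 μ = ∫∫ |Re (c' / (c -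
u)^2)| dt du`.

By Tonelli the integral over `u` can be done first. Seen from `z`, the direction to the endpoint is
equidistributed, and averaging `|cos|` gives `∫ |Re (w / (z - u)^2)| du = 2 |w| / Im z`
(`lintegral_abs_re_div_sq`). Therefore `4 μ = 2 L`.

The argument allows countably many exceptional times, so it covers polygons, parametrized edge by
edge affinely in the projective model. There the length integral equals the sum of distances,
because distance from the initial vertex has derivative equal to the speed (`integral_speed_edge`).
-/

noncomputable section

namespace HypCrofton

open MeasureTheory Set
open scoped UpperHalfPlane OnePoint

/-! ### The projective model

In the coordinates `(x, x² + y²)` the upper half plane becomes the convex region above a parabola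
and geodesics become straight lines. -/

/-- The chart of `ℍ` in which geodesics are straight. -/
def klein (z : ℍ) : ℝ × ℝ := (z.re, z.re ^ 2 + z.im ^ 2)

/-- The region above the parabola, which is the range of `klein`. -/
def kleinRegion : Set (ℝ × ℝ) := {p | p.1 ^ 2 < p.2}

/-- The inverse of `klein`, with a junk value outside of `kleinRegion`. -/
def ofKlein (p : ℝ × ℝ) : ℍ := UpperHalfPlane.ofComplex ⟨p.1, √(p.2 - p.1 ^ 2)⟩

theorem klein_mem (z : ℍ) : klein z ∈ kleinRegion := by
  simp only [klein, kleinRegion, mem_ofPred_eq]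
  have := pow_pos z.im_pos 2
  linarith

theorem coe_ofKlein {p : ℝ × ℝ} (hp : p ∈ kleinRegion) :
    (ofKlein p : ℂ) = ⟨p.1, √(p.2 - p.1 ^ 2)⟩ := by
  have h : 0 < (⟨p.1, √(p.2 - p.1 ^ 2)⟩ : ℂ).im := Real.sqrt_pos.2 (sub_pos.2 hp)
  rw [ofKlein, UpperHalfPlane.ofComplex_apply_of_im_pos h]

theorem klein_ofKlein {p : ℝ × ℝ} (hp : p ∈ kleinRegion) : klein (ofKlein p) = p := by
  have h := coe_ofKlein hp
  have h1 : (ofKlein p).re = p.1 := by rw [← UpperHalfPlane.coe_re, h]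
  have h2 : (ofKlein p).im = √(p.2 - p.1 ^ 2) := by rw [← UpperHalfPlane.coe_im, h]
  ext
  · exact h1
  · simp only [klein, h1, h2]
    rw [Real.sq_sqrt (sub_pos.2 hp).le]
    ring

theorem ofKlein_klein (z : ℍ) : ofKlein (klein z) = z := by
  apply UpperHalfPlane.ext
  rw [coe_ofKlein (klein_mem z)]
  apply Complex.ext
  · rfl
  · simp [klein, Real.sqrt_sq z.im_pos.le]

theorem klein_injective : Function.Injective klein :=
  Function.LeftInverse.injective ofKlein_klein

theorem continuous_klein : Continuous klein := by
  unfold klein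
  have := UpperHalfPlane.continuous_re
  have := UpperHalfPlane.continuous_im
  fun_prop

theorem isOpen_kleinRegion : IsOpen kleinRegion :=
  isOpen_lt (by fun_prop) (by fun_prop)

theorem convex_kleinRegion : Convex ℝ kleinRegion := by
  have h : ConvexOn ℝ univ fun x : ℝ => x ^ 2 := Even.convexOn_pow (by decide)
  have := h.convex_strict_epigraph
  simpa [kleinRegion] using this

theorem continuousOn_ofKlein : ContinuousOn ofKlein kleinRegion := by
  rw [UpperHalfPlane.isOpenEmbedding_coe.isEmbedding.continuousOn_iff]
  have h : ContinuousOn (fun p : ℝ × ℝ => (p.1 : ℂ) + (√(p.2 - p.1 ^ 2) : ℝ) * Complex.I)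
      kleinRegion := by fun_prop
  refine h.congr fun p hp => ?_
  simp only [Function.comp_apply, coe_ofKlein hp]
  apply Complex.ext <;> simp

theorem isOpenMap_klein : IsOpenMap klein := by
  intro U hU
  have h : klein '' U = kleinRegion ∩ ofKlein ⁻¹' U := by
    ext p
    constructor
    · rintro ⟨z, hz, rfl⟩
      exact ⟨klein_mem z, by simpa [ofKlein_klein] using hz⟩
    · rintro ⟨hp, hpU⟩
      exact ⟨ofKlein p, hpU, klein_ofKlein hp⟩
  rw [h]
  exact continuousOn_ofKlein.isOpen_inter_preimage isOpen_kleinRegion hU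

/-- The squared identity is the addition formula for `cosh` up to a sign. The inequality selects `d
+ e` instead of `|d - e|`. -/
theorem cosh_add_eq_of_sq {d e f : ℝ} (hd : 0 ≤ d) (he : 0 ≤ e) (hf : 0 ≤ f)
    (hle : Real.cosh d * Real.cosh e ≤ Real.cosh f)
    (hsq : (Real.cosh f - Real.cosh d * Real.cosh e) ^ 2 =
      (Real.cosh d ^ 2 - 1) * (Real.cosh e ^ 2 - 1)) : d + e = f := by
  have h1 : (Real.cosh f - Real.cosh d * Real.cosh e) ^ 2 = (Real.sinh d * Real.sinh e) ^ 2 := by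
    rw [hsq, mul_pow, Real.sinh_sq, Real.sinh_sq]
  have h2 := (sq_eq_sq₀ (sub_nonneg.2 hle)
    (mul_nonneg (Real.sinh_nonneg_iff.2 hd) (Real.sinh_nonneg_iff.2 he))).1 h1
  have h3 : Real.cosh (d + e) = Real.cosh f := by rw [Real.cosh_add]; linarith
  rw [← abs_of_nonneg (add_nonneg hd he), ← abs_of_nonneg hf]
  exact le_antisymm (Real.cosh_le_cosh.1 h3.le) (Real.cosh_le_cosh.1 h3.ge)

/-- On the hyperboloid, represent a point by `(1, re, re² + im²) / im`, so that `cosh dist` is the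
bilinear form. A convex combination in the chart then becomes a nonnegative combination `Z = l X + m
Y`, and the distances follow from `C = cosh (dist x y)` alone. -/
theorem dist_add_dist_of_mem_segment {x y z : ℍ}
    (hz : klein z ∈ segment ℝ (klein x) (klein y)) : dist x z + dist z y = dist x y := by
  obtain ⟨s, t, hs, ht, hst, h⟩ := hz
  have h1 : z.re = s * x.re + t * y.re := by
    have := congrArg Prod.fst h
    simpa [klein] using this.symm
  have h2 : z.re ^ 2 + z.im ^ 2 = s * (x.re ^ 2 + x.im ^ 2) + t * (y.re ^ 2 + y.im ^ 2) := by
    have := congrArg Prod.snd h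
    simpa [klein] using this.symm
  have hx := x.im_pos
  have hy := y.im_pos
  have hz := z.im_pos
  obtain rfl : s = 1 - t := by linarith
  set C := Real.cosh (dist x y) with hC
  have hC1 : 1 ≤ C := Real.one_le_cosh _
  have eC : 2 * x.im * y.im * C = (x.re - y.re) ^ 2 + x.im ^ 2 + y.im ^ 2 := by
    rw [hC, UpperHalfPlane.cosh_dist']
    field_simp
  set l := (1 - t) * x.im / z.im with hl
  set m := t * y.im / z.im with hm
  have hl0 : 0 ≤ l := by positivity
  have hm0 : 0 ≤ m := by positivity
  have ea : Real.cosh (dist x z) = l + m * C := by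
    rw [UpperHalfPlane.cosh_dist', hl, hm]
    field_simp
    rw [h1] at h2 ⊢
    linear_combination h2 - t * eC
  have eb : Real.cosh (dist z y) = l * C + m := by
    rw [UpperHalfPlane.cosh_dist', hl, hm]
    field_simp
    rw [h1] at h2 ⊢
    linear_combination h2 - (1 - t) * eC
  -- The normalization of `Z` as a point of the hyperboloid.
  have e1 : l ^ 2 + m ^ 2 + 2 * l * m * C = 1 := by
    rw [hl, hm]
    field_simp
    rw [h1] at h2
    linear_combination -h2 + (1 - t) * t * eC
  apply cosh_add_eq_of_sq dist_nonneg dist_nonneg dist_nonneg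
  · rw [ea, eb, ← hC]
    have : 0 ≤ l * m * (C ^ 2 - 1) := by
      have : 0 ≤ C ^ 2 - 1 := by nlinarith
      positivity
    linear_combination this + C * e1
  · rw [ea, eb, ← hC]
    have e2 : C - (l + m * C) * (l * C + m) = l * m * (C ^ 2 - 1) := by
      linear_combination -C * e1
    rw [e2]
    have e3 : (l + m * C) ^ 2 - 1 = m ^ 2 * (C ^ 2 - 1) := by linear_combination e1
    have e4 : (l * C + m) ^ 2 - 1 = l ^ 2 * (C ^ 2 - 1) := by linear_combination e1
    rw [e3, e4]
    ring

theorem segment_subset_range {x y : ℍ} {p : ℝ × ℝ} (hp : p ∈ segment ℝ (klein x) (klein y)) :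
    p ∈ kleinRegion :=
  convex_kleinRegion.segment_subset (klein_mem x) (klein_mem y) hp

theorem IsGeodesicallyConvex.convex_image {D : Set ℍ} (hD : IsGeodesicallyConvex D) :
    Convex ℝ (klein '' D) := by
  rw [convex_iff_segment_subset]
  rintro _ ⟨x, hx, rfl⟩ _ ⟨y, hy, rfl⟩ p hp
  have hp' := klein_ofKlein (segment_subset_range hp)
  refine ⟨ofKlein p, hD x hx y hy ?_, hp'⟩
  exact dist_add_dist_of_mem_segment (by rwa [hp'])

/-- Three points in the plane with vanishing determinant: one lies between the others. -/
theorem mem_segment_of_det_eq_zero {a b c : ℝ × ℝ}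
    (h : (b.1 - a.1) * (c.2 - a.2) = (c.1 - a.1) * (b.2 - a.2)) :
    c ∈ segment ℝ a b ∨ a ∈ segment ℝ c b ∨ b ∈ segment ℝ a c := by
  by_cases hab : a = b
  · subst hab
    exact .inr (.inl (right_mem_segment ℝ c a))
  have hcol : Collinear ℝ {a, b, c} := by
    rw [collinear_iff_of_mem (p₀ := a) (by simp)]
    refine ⟨b - a, ?_⟩
    have hpos : 0 < (b.1 - a.1) ^ 2 + (b.2 - a.2) ^ 2 := by
      by_contra hn
      apply hab
      ext <;> nlinarith [sq_nonneg (b.1 - a.1), sq_nonneg (b.2 - a.2)]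
    intro p hp
    simp only [mem_insert_iff, mem_singleton_iff] at hp
    rcases hp with rfl | rfl | rfl
    · exact ⟨0, by simp⟩
    · exact ⟨1, by simp⟩
    · refine ⟨((p.1 - a.1) * (b.1 - a.1) + (p.2 - a.2) * (b.2 - a.2)) /
        ((b.1 - a.1) ^ 2 + (b.2 - a.2) ^ 2), ?_⟩
      ext
      · simp
        field_simp
        linear_combination -(b.2 - a.2) * h
      · simp
        field_simp
        linear_combination (b.1 - a.1) * h
  rcases hcol.wbtw_or_wbtw_or_wbtw with h | h | h
  · exact .inr (.inr (mem_segment_iff_wbtw.2 h))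
  · exact .inl (segment_symm ℝ a b ▸ mem_segment_iff_wbtw.2 h)
  · exact .inr (.inl (mem_segment_iff_wbtw.2 h))

/-- Equality in the triangle inequality makes the Gram determinant of the three hyperboloid vectors
vanish. With denominators cleared, it is a positive multiple of the square of the collinearity
determinant. -/
theorem det_eq_zero_of_dist_add_dist {x y z : ℍ} (h : dist x z + dist z y = dist x y) :
    (y.re - x.re) * ((z.re ^ 2 + z.im ^ 2) - (x.re ^ 2 + x.im ^ 2)) =
      (z.re - x.re) * ((y.re ^ 2 + y.im ^ 2) - (x.re ^ 2 + x.im ^ 2)) := by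
  have e : Real.cosh (dist x y) - Real.cosh (dist x z) * Real.cosh (dist z y) =
      Real.sinh (dist x z) * Real.sinh (dist z y) := by
    rw [← h, Real.cosh_add]; ring
  have e2 : (Real.cosh (dist x y) - Real.cosh (dist x z) * Real.cosh (dist z y)) ^ 2 =
      (Real.cosh (dist x z) ^ 2 - 1) * (Real.cosh (dist z y) ^ 2 - 1) := by
    rw [e, mul_pow, Real.sinh_sq, Real.sinh_sq]
  rw [UpperHalfPlane.cosh_dist', UpperHalfPlane.cosh_dist', UpperHalfPlane.cosh_dist'] at e2
  have hx := x.im_pos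
  have hy := y.im_pos
  have hz := z.im_pos
  field_simp at e2
  rw [← sub_eq_zero, ← sq_eq_zero_iff]
  have hz4 : 4 * z.im ^ 2 ≠ 0 := by positivity
  refine (mul_eq_zero.1 ?_).resolve_left hz4
  linear_combination -e2

/-- Additivity of distances forces collinearity in the chart. If one of the outer points were the
middle one, the two additivity relations would make it coincide with `z`. -/
theorem geodesicSegment_eq (x y : ℍ) :
    geodesicSegment x y = klein ⁻¹' segment ℝ (klein x) (klein y) := by
  ext z
  refine ⟨fun h => ?_, fun h => dist_add_dist_of_mem_segment h⟩
  have h : dist x z + dist z y = dist x y := h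
  rcases mem_segment_of_det_eq_zero (a := klein x) (b := klein y) (c := klein z)
    (det_eq_zero_of_dist_add_dist h) with h' | h' | h'
  · exact h'
  · have h1 := dist_add_dist_of_mem_segment h'
    rw [dist_comm z x] at h1
    have : dist x z = 0 := by linarith
    rw [dist_eq_zero] at this
    subst this
    exact left_mem_segment ℝ _ _
  · have h1 := dist_add_dist_of_mem_segment h'
    rw [dist_comm y z] at h1
    have : dist z y = 0 := by linarith
    rw [dist_eq_zero] at this
    subst this
    exact right_mem_segment ℝ _ _

/-! ### Lines and convex sets in the plane -/

/-- The affine function `α X + β Y + γ` on the plane. -/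
def affineFun (α β γ : ℝ) (p : ℝ × ℝ) : ℝ := α * p.1 + β * p.2 + γ

theorem affineFun_combo {α β γ : ℝ} {s t : ℝ} (hst : s + t = 1) (p q : ℝ × ℝ) :
    affineFun α β γ (s • p + t • q) = s * affineFun α β γ p + t * affineFun α β γ q := by
  obtain rfl : s = 1 - t := by linarith
  simp [affineFun]
  ring

/-- If an interior point is off the line, then `A` or `B` lies on the other side. The open segment
to it stays in the interior and crosses the line. -/
theorem exists_interior_affineFun_eq_zero {K : Set (ℝ × ℝ)} (hK : Convex ℝ K)
    (hi : (interior K).Nonempty) {α β γ : ℝ} {A B : ℝ × ℝ} (hA : A ∈ K) (hB : B ∈ K)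
    (hA0 : affineFun α β γ A < 0) (hB0 : 0 < affineFun α β γ B) :
    ∃ o ∈ interior K, affineFun α β γ o = 0 := by
  obtain ⟨w, hw⟩ := hi
  have key : ∀ P ∈ K, affineFun α β γ w * affineFun α β γ P < 0 →
      ∃ o ∈ interior K, affineFun α β γ o = 0 := by
    intro P hP hneg
    set l := affineFun α β γ w
    set m := affineFun α β γ P
    have hlm : 0 < (m - l) ^ 2 := by nlinarith [sq_nonneg l, sq_nonneg m]
    have hlm' : m - l ≠ 0 := fun h => by simp [h] at hlm
    have hs : 0 < m / (m - l) := by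
      rw [div_eq_mul_inv, ← mul_inv_cancel_left₀ hlm' (m * (m - l)⁻¹)]
      have : (m - l) * ((m - l)⁻¹ * (m * (m - l)⁻¹)) = (m * (m - l)) / (m - l) ^ 2 := by
        field_simp
      rw [this]
      exact div_pos (by nlinarith [sq_nonneg m]) hlm
    have ht : 0 < -l / (m - l) := by
      have : -l / (m - l) = (-l * (m - l)) / (m - l) ^ 2 := by field_simp
      rw [this]
      exact div_pos (by nlinarith [sq_nonneg l]) hlm
    have hst : m / (m - l) + -l / (m - l) = 1 := by field_simp; ring
    -- These weights give the zero of the affine function on the segment from `w` to `P`.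
    refine ⟨(m / (m - l)) • w + (-l / (m - l)) • P,
      hK.openSegment_interior_self_subset_interior hw hP ⟨_, _, hs, ht, hst, rfl⟩, ?_⟩
    rw [affineFun_combo hst]
    change m / (m - l) * l + -l / (m - l) * m = 0
    ring
  rcases lt_trichotomy (affineFun α β γ w) 0 with h | h | h
  · exact key B hB (mul_neg_of_neg_of_pos h hB0)
  · exact ⟨w, hw, h⟩
  · exact key A hA (mul_neg_of_pos_of_neg h hA0)

/-- A line through an interior point of a convex set contains at most two boundary points. -/
theorem not_three_on_line {K : Set (ℝ × ℝ)} (hK : Convex ℝ K) {α β γ : ℝ}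
    (hαβ : α ≠ 0 ∨ β ≠ 0) {o : ℝ × ℝ} (ho : o ∈ interior K) (ho0 : affineFun α β γ o = 0)
    {z : Fin 3 → ℝ × ℝ} (hz : Function.Injective z) (hzK : ∀ i, z i ∈ K \ interior K)
    (hz0 : ∀ i, affineFun α β γ (z i) = 0) : False := by
  have hpos : 0 < α ^ 2 + β ^ 2 := by
    rcases hαβ with h | h <;> positivity
  -- Coordinates along the line, with origin at the interior point `o`.
  have hs : ∀ i, ∃ s : ℝ, z i = o + s • ((-β, α) : ℝ × ℝ) := by
    intro i
    have h1 := hz0 i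
    simp only [affineFun] at h1 ho0
    refine ⟨(α * ((z i).2 - o.2) - β * ((z i).1 - o.1)) / (α ^ 2 + β ^ 2), ?_⟩
    ext
    · simp
      field_simp
      linear_combination α * h1 - α * ho0
    · simp
      field_simp
      linear_combination β * h1 - β * ho0
  choose s hs using hs
  have hinj : ∀ i j, i ≠ j → s i ≠ s j := by
    intro i j hij h
    exact hij (hz (by rw [hs i, hs j, h]))
  have hne : ∀ i, s i ≠ 0 := by
    intro i h
    have := hs i
    rw [h, zero_smul, add_zero] at this
    exact (hzK i).2 (this ▸ ho)
  -- A point strictly between `o` and a point of `K` is interior. So two of the `z i` cannot lie on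
  -- the same side of `o`, which is impossible for three of them.
  have key : ∀ i j (r : ℝ), 0 < r → r < 1 → s i ≠ r * s j := by
    intro i j r h0 h1 h
    refine (hzK i).2 (hK.openSegment_interior_self_subset_interior ho (hzK j).1
      ⟨1 - r, r, by linarith, h0, by ring, ?_⟩)
    rw [hs i, hs j, h]
    ext <;> simp <;> ring
  have hpp : ∀ i j, i ≠ j → 0 < s i → s j < 0 := by
    intro i j hij hi
    by_contra hj
    have hj' : 0 < s j := lt_of_le_of_ne (not_lt.1 hj) (hne j).symm
    rcases lt_or_gt_of_ne (hinj i j hij) with h | h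
    · exact key i j (s i / s j) (by positivity) ((div_lt_one hj').2 h) (by field_simp)
    · exact key j i (s j / s i) (by positivity) ((div_lt_one hi).2 h) (by field_simp)
  have hnn : ∀ i j, i ≠ j → s i < 0 → 0 < s j := by
    intro i j hij hi
    by_contra hj
    have hj' : s j < 0 := lt_of_le_of_ne (not_lt.1 hj) (hne j)
    rcases lt_or_gt_of_ne (hinj i j hij) with h | h
    · exact key j i (s j / s i) (div_pos_of_neg_of_neg hj' hi)
        ((div_lt_one_of_neg hi).2 h) (div_mul_cancel₀ _ hi.ne).symm
    · exact key i j (s i / s j) (div_pos_of_neg_of_neg hi hj')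
        ((div_lt_one_of_neg hj').2 h) (div_mul_cancel₀ _ hj'.ne).symm
  rcases lt_or_gt_of_ne (hne 0) with h | h
  · have h1 := hnn 0 1 (by decide) h
    have h2 := hnn 0 2 (by decide) h
    exact absurd (hpp 1 2 (by decide) h1) h2.not_gt
  · have h1 := hpp 0 1 (by decide) h
    have h2 := hpp 0 2 (by decide) h
    exact absurd (hnn 1 2 (by decide) h1) h2.not_gt

/-- A small move from `o` along the gradient `(α, β)` stays in `K`. -/
theorem exists_affineFun_pos_of_interior {K : Set (ℝ × ℝ)} {α β γ : ℝ} (hαβ : α ≠ 0 ∨ β ≠ 0)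
    {o : ℝ × ℝ} (ho : o ∈ interior K) (ho0 : affineFun α β γ o = 0) :
    ∃ q ∈ K, 0 < affineFun α β γ q := by
  have hpos : 0 < α ^ 2 + β ^ 2 := by
    rcases hαβ with h | h <;> positivity
  have hc : Filter.Tendsto (fun r : ℝ => o + r • ((α, β) : ℝ × ℝ)) (nhdsWithin 0 (Ioi 0))
      (nhds o) := by
    have : Continuous fun r : ℝ => o + r • ((α, β) : ℝ × ℝ) := by fun_prop
    simpa using (this.tendsto 0).mono_left nhdsWithin_le_nhds
  have h1 := hc.eventually (mem_interior_iff_mem_nhds.1 ho)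
  obtain ⟨r, hr, hr0⟩ := (h1.and self_mem_nhdsWithin).exists
  refine ⟨_, hr, ?_⟩
  have hr0 : 0 < r := hr0
  have : affineFun α β γ (o + r • ((α, β) : ℝ × ℝ)) = r * (α ^ 2 + β ^ 2) := by
    simp only [affineFun] at ho0 ⊢
    simp
    linear_combination ho0
  rw [this]
  positivity

/-! ### The pencil of geodesics with a common endpoint -/

/-- The function `Re (-1 / (z - u))`, whose level sets are the geodesics with endpoint `u`. -/
def pencil (u : ℝ) (z : ℍ) : ℝ := (u - z.re) / ((z.re - u) ^ 2 + z.im ^ 2)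

theorem pencil_denom_pos (u : ℝ) (z : ℍ) : 0 < (z.re - u) ^ 2 + z.im ^ 2 := by
  have := z.im_pos
  positivity

theorem pencil_eq_re (u : ℝ) (z : ℍ) : pencil u z = (-1 / ((z : ℂ) - u)).re := by
  rw [Complex.div_re]
  simp [pencil, Complex.normSq_apply]
  ring_nf

/-- The affine function, in the projective model, that vanishes where `pencil u = a`. -/
def pencilFun (u a : ℝ) : ℝ × ℝ → ℝ := affineFun (2 * u * a - 1) (-a) (u - a * u ^ 2)

/-- The factor is positive, so the sign of the affine function compares `pencil u` with `a`. In
particular the level sets of the pencil are straight in the chart. -/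
theorem pencilFun_klein (u a : ℝ) (z : ℍ) :
    pencilFun u a (klein z) = (pencil u z - a) * ((z.re - u) ^ 2 + z.im ^ 2) := by
  have := (pencil_denom_pos u z).ne'
  simp only [pencilFun, affineFun, klein, pencil]
  field_simp
  ring

theorem pencilFun_nontrivial (u a : ℝ) : 2 * u * a - 1 ≠ 0 ∨ -a ≠ 0 := by
  by_cases h : a = 0
  · left; simp [h]
  · right; simpa using h

theorem pencilFun_klein_eq_zero {u a : ℝ} {z : ℍ} :
    pencilFun u a (klein z) = 0 ↔ pencil u z = a := by
  rw [pencilFun_klein, mul_eq_zero, sub_eq_zero]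
  simp [(pencil_denom_pos u z).ne']

theorem pencilFun_klein_pos {u a : ℝ} {z : ℍ} :
    0 < pencilFun u a (klein z) ↔ a < pencil u z := by
  rw [pencilFun_klein, mul_pos_iff_of_pos_right (pencil_denom_pos u z), sub_pos]

theorem pencilFun_klein_neg {u a : ℝ} {z : ℍ} :
    pencilFun u a (klein z) < 0 ↔ pencil u z < a := by
  rw [pencilFun_klein, ← neg_pos, ← neg_mul,
    mul_pos_iff_of_pos_right (pencil_denom_pos u z), neg_pos, sub_neg]

theorem continuous_pencil (u : ℝ) : Continuous (pencil u) := by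
  unfold pencil
  have := UpperHalfPlane.continuous_re
  have := UpperHalfPlane.continuous_im
  exact Continuous.div (by fun_prop) (by fun_prop) fun z => (pencil_denom_pos u z).ne'

/-! ### Level sets and extrema of a pencil on a convex domain -/

section Domain

variable {D : Set ℍ}

theorem klein_mem_interior_iff {z : ℍ} : klein z ∈ interior (klein '' D) ↔ z ∈ interior D := by
  constructor
  · intro h
    have := preimage_interior_subset_interior_preimage continuous_klein h
    rwa [preimage_image_eq _ klein_injective] at this
  · intro h
    exact isOpenMap_klein.image_interior_subset D ⟨z, h, rfl⟩

theorem IsCompactConvexDomain.klein_mem_diff (hD : IsCompactConvexDomain D) {z : ℍ}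
    (hz : z ∈ frontier D) : klein z ∈ klein '' D \ interior (klein '' D) :=
  ⟨⟨z, hD.isCompact.isClosed.frontier_subset hz, rfl⟩,
    fun h => hz.2 (klein_mem_interior_iff.1 h)⟩

/-- Values on both sides of `a` force the level line through the interior. Without this it could be
a supporting line containing a whole edge of the boundary. -/
theorem IsCompactConvexDomain.not_three_on_level (hD : IsCompactConvexDomain D) {u a : ℝ}
    {A B : ℍ} (hA : A ∈ D) (hB : B ∈ D) (hAa : pencil u A < a) (haB : a < pencil u B)
    {z : Fin 3 → ℍ} (hz : Function.Injective z) (hzD : ∀ i, z i ∈ frontier D)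
    (hza : ∀ i, pencil u (z i) = a) : False := by
  have hK := hD.convex.convex_image
  have hi : (interior (klein '' D)).Nonempty := by
    obtain ⟨w, hw⟩ := hD.interior_nonempty
    exact ⟨klein w, klein_mem_interior_iff.2 hw⟩
  obtain ⟨o, ho, ho0⟩ := exists_interior_affineFun_eq_zero hK hi
    (mem_image_of_mem klein hA) (mem_image_of_mem klein hB)
    (pencilFun_klein_neg.2 hAa) (pencilFun_klein_pos.2 haB)
  exact not_three_on_line hK (pencilFun_nontrivial u a) ho ho0
    (z := klein ∘ z) (klein_injective.comp hz) (fun i => hD.klein_mem_diff (hzD i))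
    (fun i => pencilFun_klein_eq_zero.2 (hza i))

theorem exists_pencil_gt_of_interior (u : ℝ) {z : ℍ} (hz : z ∈ interior D) :
    ∃ w ∈ D, pencil u z < pencil u w := by
  obtain ⟨_, ⟨w, hw, rfl⟩, h⟩ := exists_affineFun_pos_of_interior
    (pencilFun_nontrivial u (pencil u z)) (klein_mem_interior_iff.2 hz)
    (pencilFun_klein_eq_zero.2 rfl)
  exact ⟨w, hw, pencilFun_klein_pos.1 h⟩

theorem exists_pencil_lt_of_interior (u : ℝ) {z : ℍ} (hz : z ∈ interior D) :
    ∃ w ∈ D, pencil u w < pencil u z := by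
  -- Negating the coefficients reduces a smaller value to the case of a larger one.
  have e : ∀ p, affineFun (-(2 * u * pencil u z - 1)) (pencil u z)
      (-(u - pencil u z * u ^ 2)) p = -pencilFun u (pencil u z) p := by
    intro p
    simp only [affineFun, pencilFun]
    ring
  have hnt := pencilFun_nontrivial u (pencil u z)
  obtain ⟨_, ⟨w, hw, rfl⟩, h⟩ := exists_affineFun_pos_of_interior
    (α := -(2 * u * pencil u z - 1)) (β := pencil u z) (γ := -(u - pencil u z * u ^ 2))
    (by rwa [neg_ne_zero, ← neg_ne_zero (a := pencil u z)]) (klein_mem_interior_iff.2 hz)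
    (by rw [e, pencilFun_klein_eq_zero.2 rfl, neg_zero])
  rw [e, neg_pos] at h
  exact ⟨w, hw, pencilFun_klein_neg.1 h⟩

theorem IsCompactConvexDomain.nonempty (hD : IsCompactConvexDomain D) : D.Nonempty :=
  hD.interior_nonempty.mono interior_subset

theorem IsCompactConvexDomain.isConnected (hD : IsCompactConvexDomain D) : IsConnected D := by
  refine ⟨hD.nonempty, ?_⟩
  have h := hD.convex.convex_image.isPreconnected.image ofKlein (continuousOn_ofKlein.mono (by
    rintro _ ⟨z, -, rfl⟩
    exact klein_mem z))
  rwa [image_image, show (fun z => ofKlein (klein z)) = id from funext ofKlein_klein,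
    image_id] at h

/-- The values of `pencil u` on a domain form an interval whose end points are attained on the
boundary. -/
theorem IsCompactConvexDomain.exists_pencil_image (hD : IsCompactConvexDomain D) (u : ℝ) :
    ∃ a ∈ frontier D, ∃ b ∈ frontier D, pencil u a ≤ pencil u b ∧
      pencil u '' D = Icc (pencil u a) (pencil u b) := by
  have hcon := hD.isConnected.image (pencil u) (continuous_pencil u).continuousOn
  have hcpt := hD.isCompact.image (continuous_pencil u)
  obtain ⟨a, ha, hamin⟩ := hD.isCompact.exists_isMinOn hD.nonempty (continuous_pencil u).continuousOn
  obtain ⟨b, hb, hbmax⟩ := hD.isCompact.exists_isMaxOn hD.nonempty (continuous_pencil u).continuousOn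
  rw [isMinOn_iff] at hamin
  rw [isMaxOn_iff] at hbmax
  refine ⟨a, ⟨subset_closure ha, fun h => ?_⟩, b, ⟨subset_closure hb, fun h => ?_⟩,
    hamin b hb, ?_⟩
  · obtain ⟨w, hw, hlt⟩ := exists_pencil_lt_of_interior u h
    exact (hamin w hw).not_gt hlt
  · obtain ⟨w, hw, hlt⟩ := exists_pencil_gt_of_interior u h
    exact (hbmax w hw).not_gt hlt
  · apply Subset.antisymm
    · rintro _ ⟨w, hw, rfl⟩
      exact ⟨hamin w hw, hbmax w hw⟩
    · exact hcon.isPreconnected.Icc_subset (mem_image_of_mem _ ha) (mem_image_of_mem _ hb)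

end Domain

/-! ### The Liouville measure as an iterated integral -/

theorem Geodesic.ofEndpoints_eq_iff (p q : EndpointPair) :
    Geodesic.ofEndpoints p = Geodesic.ofEndpoints q ↔
      p.1 = q.1 ∨ p.1 = q.1.swap := by
  refine Subtype.ext_iff.trans ?_
  change s(p.1.1, p.1.2) = s(q.1.1, q.1.2) ↔ _
  rw [Sym2.eq_iff, Prod.ext_iff, Prod.ext_iff]
  rfl

theorem Geodesic.ofReal_injective : Function.Injective Geodesic.ofReal := by
  rintro ⟨⟨a, b⟩, hab⟩ ⟨⟨c, d⟩, hcd⟩ h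
  rw [Geodesic.ofReal, Geodesic.ofReal, Geodesic.ofEndpoints_eq_iff] at h
  simp only [Prod.mk.injEq, Prod.swap_prod_mk, OnePoint.coe_eq_coe] at h hab hcd
  rcases h with ⟨rfl, rfl⟩ | ⟨rfl, rfl⟩
  · rfl
  · exact absurd hab hcd.not_gt

/-- The preimage of an image in the space of ordered pairs is the open set together with its mirror
image under the exchange. -/
theorem Geodesic.isOpenMap_ofReal : IsOpenMap Geodesic.ofReal := by
  intro U hU
  rw [isOpen_coinduced]
  set V : Set (OnePoint ℝ × OnePoint ℝ) :=
    (fun p : ℝ × ℝ => ((p.1 : OnePoint ℝ), (p.2 : OnePoint ℝ))) '' (Subtype.val '' U) with hV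
  have hVo : IsOpen V := by
    have h1 : IsOpen (Subtype.val '' U : Set (ℝ × ℝ)) :=
      (isOpen_lt continuous_fst continuous_snd).isOpenMap_subtype_val U hU
    exact (OnePoint.isOpenEmbedding_coe.isOpenMap.prodMap
      OnePoint.isOpenEmbedding_coe.isOpenMap) _ h1
  have h : Geodesic.ofEndpoints ⁻¹' (Geodesic.ofReal '' U) =
      Subtype.val ⁻¹' (V ∪ Prod.swap ⁻¹' V) := by
    ext q
    constructor
    · rintro ⟨p, hp, h⟩
      rw [Geodesic.ofReal, Geodesic.ofEndpoints_eq_iff] at h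
      rcases h with h | h
      · exact .inl ⟨p.1, ⟨p, hp, rfl⟩, h⟩
      · exact .inr ⟨p.1, ⟨p, hp, rfl⟩, h⟩
    · rintro (⟨_, ⟨p, hp, rfl⟩, h⟩ | ⟨_, ⟨p, hp, rfl⟩, h⟩)
      · exact ⟨p, hp, (Geodesic.ofEndpoints_eq_iff _ _).2 (.inl h)⟩
      · exact ⟨p, hp, (Geodesic.ofEndpoints_eq_iff _ _).2 (.inr h)⟩
  rw [h]
  exact (hVo.union (hVo.preimage continuous_swap)).preimage continuous_subtype_val

theorem Geodesic.measurableEmbedding_ofReal : MeasurableEmbedding Geodesic.ofReal :=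
  (Topology.IsOpenEmbedding.of_continuous_injective_isOpenMap Geodesic.continuous_ofReal
    Geodesic.ofReal_injective Geodesic.isOpenMap_ofReal).measurableEmbedding

/-- The pairs of real endpoints whose geodesic meets `D`. -/
def meetingPairs (D : Set ℍ) : Set (ℝ × ℝ) :=
  {p | ∃ z ∈ D, z.re ^ 2 + z.im ^ 2 - (p.1 + p.2) * z.re + p.1 * p.2 = 0}

theorem mem_points_ofReal (p : RealPair) (z : ℍ) :
    z ∈ (Geodesic.ofReal p).points ↔
      z.re ^ 2 + z.im ^ 2 - (p.1.1 + p.1.2) * z.re + p.1.1 * p.1.2 = 0 := by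
  change dist (z : ℂ) (((p.1.1 + p.1.2) / 2 : ℝ) : ℂ) = |p.1.1 - p.1.2| / 2 ↔ _
  rw [← sq_eq_sq₀ dist_nonneg (by positivity), Complex.dist_eq, ← Complex.normSq_eq_norm_sq,
    Complex.normSq_apply, div_pow, sq_abs]
  simp only [Complex.sub_re, Complex.sub_im, Complex.ofReal_re, Complex.ofReal_im,
    UpperHalfPlane.coe_re, UpperHalfPlane.coe_im]
  constructor <;> intro h <;> linear_combination h

theorem meetingPairs_swap {D : Set ℍ} (p : ℝ × ℝ) :
    p.swap ∈ meetingPairs D ↔ p ∈ meetingPairs D := by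
  simp only [meetingPairs, mem_ofPred_eq, Prod.fst_swap, Prod.snd_swap, add_comm, mul_comm]

/-- Projection along a compact factor is closed. This supplies the measurability of the domain of
integration. -/
theorem isClosed_meetingPairs {D : Set ℍ} (hD : IsCompact D) : IsClosed (meetingPairs D) := by
  have : CompactSpace D := isCompact_iff_compactSpace.1 hD
  have hre := UpperHalfPlane.continuous_re
  have him := UpperHalfPlane.continuous_im
  have hc : IsClosed {q : (ℝ × ℝ) × D | (q.2 : ℍ).re ^ 2 + (q.2 : ℍ).im ^ 2 -
      (q.1.1 + q.1.2) * (q.2 : ℍ).re + q.1.1 * q.1.2 = 0} :=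
    isClosed_eq (by fun_prop) continuous_const
  have h := isClosedMap_fst_of_compactSpace _ hc
  convert h using 1
  ext p
  simp [meetingPairs]

/-- The density of the Liouville measure. -/
def liouvilleDensity (p : ℝ × ℝ) : ENNReal := ENNReal.ofReal (1 / |p.1 - p.2| ^ 2)

theorem measurable_liouvilleDensity : Measurable liouvilleDensity := by
  unfold liouvilleDensity
  fun_prop

theorem liouville_geodesicsMeeting {D : Set ℍ} (hD : IsCompact D) :
    liouville (geodesicsMeeting D) =
      ∫⁻ p in meetingPairs D ∩ {p | p.1 < p.2}, liouvilleDensity p := by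
  have hm : MeasurableSet (meetingPairs D ∩ {p : ℝ × ℝ | p.1 < p.2}) :=
    (isClosed_meetingPairs hD).measurableSet.inter (measurableSet_lt measurable_fst measurable_snd)
  rw [liouville, Geodesic.measurableEmbedding_ofReal.map_apply,
    (MeasurableEmbedding.subtype_coe
      (measurableSet_lt measurable_fst measurable_snd)).comap_apply,
    ← withDensity_apply _ hm]
  congr 1
  ext p
  constructor
  · rintro ⟨q, ⟨z, hz, hzD⟩, rfl⟩
    exact ⟨⟨z, hzD, (mem_points_ofReal q z).1 hz⟩, q.2⟩
  · rintro ⟨⟨z, hzD, hz⟩, hp⟩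
    exact ⟨⟨p, hp⟩, ⟨z, (mem_points_ofReal ⟨p, hp⟩ z).2 hz, hzD⟩, rfl⟩

theorem two_mul_liouville_geodesicsMeeting {D : Set ℍ} (hD : IsCompact D) :
    2 * liouville (geodesicsMeeting D) = ∫⁻ p in meetingPairs D, liouvilleDensity p := by
  have hM := (isClosed_meetingPairs hD).measurableSet
  have hlt : MeasurableSet {p : ℝ × ℝ | p.1 < p.2} := measurableSet_lt measurable_fst measurable_snd
  have hgt : MeasurableSet {p : ℝ × ℝ | p.2 < p.1} := measurableSet_lt measurable_snd measurable_fst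
  have hswap : ∫⁻ p in meetingPairs D ∩ {p | p.2 < p.1}, liouvilleDensity p =
      ∫⁻ p in meetingPairs D ∩ {p | p.1 < p.2}, liouvilleDensity p := by
    have hmp : MeasurePreserving (Prod.swap : ℝ × ℝ → ℝ × ℝ) volume volume :=
      Measure.measurePreserving_swap
    rw [← hmp.setLIntegral_comp_preimage (hM.inter hlt) measurable_liouvilleDensity]
    have hs : Prod.swap ⁻¹' (meetingPairs D ∩ {p : ℝ × ℝ | p.1 < p.2}) =
        meetingPairs D ∩ {p | p.2 < p.1} := by
      ext p
      exact and_congr (meetingPairs_swap p) Iff.rfl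
    rw [hs]
    refine lintegral_congr fun p => ?_
    simp [liouvilleDensity, abs_sub_comm]
  have hdisj : Disjoint (meetingPairs D ∩ {p | p.1 < p.2}) (meetingPairs D ∩ {p | p.2 < p.1}) :=
    Set.disjoint_left.2 fun p hp hq => lt_asymm (mem_ofPred.1 hp.2) (mem_ofPred.1 hq.2)
  rw [two_mul, liouville_geodesicsMeeting hD]
  nth_rewrite 2 [← hswap]
  rw [← lintegral_union (hM.inter hgt) hdisj, ← lintegral_indicator hM,
    ← lintegral_indicator ((hM.inter hlt).union (hM.inter hgt))]
  refine lintegral_congr fun p => ?_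
  rcases lt_trichotomy p.1 p.2 with h | h | h
  · by_cases hp : p ∈ meetingPairs D <;> simp [indicator, hp, h]
  -- On the diagonal the density is `0`, because division by zero gives zero.
  · by_cases hp : p ∈ meetingPairs D <;> simp [indicator, hp, h, liouvilleDensity]
  · by_cases hp : p ∈ meetingPairs D <;> simp [indicator, hp, h]

theorem mk_mem_meetingPairs {D : Set ℍ} {u v : ℝ} (h : v ≠ u) :
    (u, v) ∈ meetingPairs D ↔ -1 / (v - u) ∈ pencil u '' D := by
  have hvu : v - u ≠ 0 := sub_ne_zero.2 h
  refine exists_congr fun z => and_congr_right fun _ => ?_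
  have := (pencil_denom_pos u z).ne'
  rw [pencil, div_eq_div_iff this hvu]
  constructor <;> intro h <;> linear_combination h

/-- The substitution `x = -1 / (v - u)` has the Liouville density as its Jacobian, so the slice has
the Lebesgue measure of an interval. -/
theorem lintegral_slice_meetingPairs {D : Set ℍ} {u a b : ℝ}
    (hab : pencil u '' D = Icc a b) :
    ∫⁻ v, (meetingPairs D).indicator liouvilleDensity (u, v) = ENNReal.ofReal (b - a) := by
  set s : Set ℝ := {v | v ≠ u ∧ -1 / (v - u) ∈ Icc a b} with hs
  have hsm : MeasurableSet s := by
    refine MeasurableSet.inter (measurableSet_singleton u).compl ?_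
    have : Measurable fun v : ℝ => -1 / (v - u) := by fun_prop
    exact this measurableSet_Icc
  have hderiv : ∀ v ∈ s, HasDerivWithinAt (fun v => -1 / (v - u)) (1 / (v - u) ^ 2) s v := by
    intro v hv
    have hvu : v - u ≠ 0 := sub_ne_zero.2 hv.1
    have h := ((hasDerivAt_id v).sub_const u).inv hvu
    have h2 := h.neg
    refine (h2.congr_deriv ?_).hasDerivWithinAt.congr ?_ ?_
    · simp; ring
    · intro w _; simp [neg_div]
    · simp [neg_div]
  have hinj : InjOn (fun v : ℝ => -1 / (v - u)) s := by
    intro v hv w hw h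
    have hvu : v - u ≠ 0 := sub_ne_zero.2 hv.1
    have hwu : w - u ≠ 0 := sub_ne_zero.2 hw.1
    simp only at h
    rw [div_eq_div_iff hvu hwu] at h
    linarith
  -- The level `0` belongs to the geodesic from `u` to `∞` and is not attained by a real `v`. A
  -- single point does not affect the measure.
  have himg : (fun v : ℝ => -1 / (v - u)) '' s = Icc a b \ {0} := by
    ext x
    constructor
    · rintro ⟨v, hv, rfl⟩
      have hvu : v - u ≠ 0 := sub_ne_zero.2 hv.1
      exact ⟨hv.2, by simp [hvu]⟩
    · rintro ⟨hx, hx0⟩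
      have hx0 : x ≠ 0 := hx0
      have e : -1 / (u - 1 / x - u) = x := by field_simp; simp
      refine ⟨u - 1 / x, ⟨?_, ?_⟩, e⟩
      · simp [hx0]
      · rwa [e]
  have h1 := lintegral_image_eq_lintegral_abs_deriv_mul hsm hderiv hinj (fun _ => 1)
  rw [himg, setLIntegral_one, measure_sdiff_null (by simp), Real.volume_Icc] at h1
  rw [h1, ← lintegral_indicator hsm]
  refine lintegral_congr fun v => ?_
  by_cases hvu : v = u
  · subst hvu
    have : v ∉ s := fun h => h.1 rfl
    rw [indicator_of_notMem this]
    by_cases hv : (v, v) ∈ meetingPairs D <;> simp [indicator, hv, liouvilleDensity]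
  · by_cases hv : (u, v) ∈ meetingPairs D
    · have hvs : v ∈ s := ⟨hvu, hab ▸ (mk_mem_meetingPairs hvu).1 hv⟩
      rw [indicator_of_mem hv, indicator_of_mem hvs, liouvilleDensity, mul_one, sq_abs,
        abs_of_nonneg (by positivity)]
      congr 2
      ring
    · have hvs : v ∉ s := fun h => hv ((mk_mem_meetingPairs hvu).2 (hab ▸ h.2))
      rw [indicator_of_notMem hv, indicator_of_notMem hvs]

theorem two_mul_liouville_eq_lintegral {D : Set ℍ} (hD : IsCompact D) {a b : ℝ → ℝ}
    (hab : ∀ u, pencil u '' D = Icc (a u) (b u)) :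
    2 * liouville (geodesicsMeeting D) = ∫⁻ u, ENNReal.ofReal (b u - a u) := by
  have hM := (isClosed_meetingPairs hD).measurableSet
  rw [two_mul_liouville_geodesicsMeeting hD, ← lintegral_indicator hM, Measure.volume_eq_prod,
    lintegral_prod _ (measurable_liouvilleDensity.indicator hM).aemeasurable]
  exact lintegral_congr fun u => lintegral_slice_meetingPairs (hab u)

/-! ### Total variation of a function with at most two crossings of each level -/

theorem integral_abs_deriv_of_monotoneOn {g g' : ℝ → ℝ} {p q : ℝ} (hpq : p ≤ q)
    (hg : ContinuousOn g (Icc p q)) {S : Set ℝ} (hS : S.Countable)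
    (hd : ∀ t ∈ Ioo p q \ S, HasDerivAt g (g' t) t) (hi : IntervalIntegrable g' volume p q)
    (hm : MonotoneOn g (Icc p q)) : ∫ t in p..q, |g' t| = g q - g p := by
  rw [← integral_eq_of_hasDerivAt_off_countable_of_le g g' hpq hS hg hd hi]
  rw [intervalIntegral.integral_of_le hpq, intervalIntegral.integral_of_le hpq,
    integral_Ioc_eq_integral_Ioo, integral_Ioc_eq_integral_Ioo]
  refine setIntegral_congr_ae measurableSet_Ioo ?_
  filter_upwards [hS.ae_notMem volume] with t htS ht
  rw [abs_of_nonneg]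
  have h := hd t ⟨ht, htS⟩
  have hu : UniqueDiffWithinAt ℝ (Icc p q) t :=
    uniqueDiffOn_Icc (ht.1.trans ht.2) t (Ioo_subset_Icc_self ht)
  rw [← h.hasDerivWithinAt.derivWithin hu]
  exact hm.derivWithin_nonneg

theorem integral_abs_deriv_of_antitoneOn {g g' : ℝ → ℝ} {p q : ℝ} (hpq : p ≤ q)
    (hg : ContinuousOn g (Icc p q)) {S : Set ℝ} (hS : S.Countable)
    (hd : ∀ t ∈ Ioo p q \ S, HasDerivAt g (g' t) t) (hi : IntervalIntegrable g' volume p q)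
    (hm : AntitoneOn g (Icc p q)) : ∫ t in p..q, |g' t| = g p - g q := by
  have h := integral_abs_deriv_of_monotoneOn hpq hg.neg hS (fun t ht => (hd t ht).neg) hi.neg hm.neg
  simp only [Pi.neg_apply, abs_neg] at h
  rw [h]
  ring

/-- The function falls to its minimum at `t₀`, rises to its maximum at `t₁`, then falls again. A
failure of monotonicity on any of these pieces would, by the intermediate value theorem, produce a
level taken three times. Since `g 0 = g T`, the three variations add up to twice the oscillation. -/
theorem integral_abs_deriv_of_le {g g' : ℝ → ℝ} {T t₀ t₁ : ℝ} (h0 : 0 ≤ t₀) (h01 : t₀ ≤ t₁)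
    (h1 : t₁ ≤ T) (hg : ContinuousOn g (Icc 0 T)) {S : Set ℝ} (hS : S.Countable)
    (hd : ∀ t ∈ Ioo 0 T \ S, HasDerivAt g (g' t) t) (hi : IntervalIntegrable g' volume 0 T)
    (hT : g 0 = g T) (hr : ∀ t ∈ Icc 0 T, g t ∈ Icc (g t₀) (g t₁))
    (hlevel : ∀ a ∈ Ioo (g t₀) (g t₁), ∀ r ∈ Ioo 0 T, ∀ s ∈ Ioo 0 T, ∀ t ∈ Ioo 0 T,
      r < s → s < t → g r = a → g s = a → g t = a → False) :
    ∫ t in 0..T, |g' t| = 2 * (g t₁ - g t₀) := by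
  have up : ∀ {a p q : ℝ}, 0 ≤ p → p ≤ q → q ≤ T → g p < a → a < g q →
      ∃ r, p < r ∧ r < q ∧ g r = a := by
    intro a p q hp hpq hq ha hb
    obtain ⟨r, hr, e⟩ := intermediate_value_Ioo hpq (hg.mono (Icc_subset_Icc hp hq)) ⟨ha, hb⟩
    exact ⟨r, hr.1, hr.2, e⟩
  have down : ∀ {a p q : ℝ}, 0 ≤ p → p ≤ q → q ≤ T → a < g p → g q < a →
      ∃ r, p < r ∧ r < q ∧ g r = a := by
    intro a p q hp hpq hq ha hb
    obtain ⟨r, hr, e⟩ := intermediate_value_Ioo' hpq (hg.mono (Icc_subset_Icc hp hq)) ⟨hb, ha⟩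
    exact ⟨r, hr.1, hr.2, e⟩
  have bad : ∀ {a r s t : ℝ}, g t₀ < a → a < g t₁ → 0 < r → r < s → s < t → t < T → g r = a →
      g s = a → g t = a → False := fun ha hb hr hrs hst ht e1 e2 e3 =>
    hlevel _ ⟨ha, hb⟩ _ ⟨hr, hrs.trans (hst.trans ht)⟩ _ ⟨hr.trans hrs, hst.trans ht⟩ _
      ⟨hr.trans (hrs.trans hst), ht⟩ hrs hst e1 e2 e3
  -- A rise before `t₀` forces a rise, a descent to the minimum, and the rise to the maximum, all
  -- through the same level.
  have m1 : AntitoneOn g (Icc 0 t₀) := by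
    intro s hs s' hs' hss
    by_contra! hlt
    obtain ⟨a, ha, ha'⟩ := exists_between hlt
    have b1 := (hr s ⟨hs.1, by linarith [hs.2]⟩).1
    have b2 := (hr s' ⟨hs'.1, by linarith [hs'.2]⟩).2
    obtain ⟨r₁, x1, y1, e1⟩ := up hs.1 hss (by linarith [hs'.2]) ha ha'
    obtain ⟨r₂, x2, y2, e2⟩ := down hs'.1 hs'.2 (by linarith) ha' (by linarith)
    obtain ⟨r₃, x3, y3, e3⟩ := up h0 h01 h1 (by linarith : g t₀ < a) (by linarith)
    exact bad (by linarith) (by linarith) (by linarith [hs.1]) (by linarith) (by linarith)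
      (by linarith) e1 e2 e3
  have m2 : MonotoneOn g (Icc t₀ t₁) := by
    intro s hs s' hs' hss
    by_contra! hlt
    obtain ⟨a, ha, ha'⟩ := exists_between hlt
    have b1 := (hr s ⟨by linarith [hs.1], by linarith [hs.2]⟩).2
    have b2 := (hr s' ⟨by linarith [hs'.1], by linarith [hs'.2]⟩).1
    obtain ⟨r₁, x1, y1, e1⟩ := up h0 hs.1 (by linarith [hs.2]) (by linarith : g t₀ < a) ha'
    obtain ⟨r₂, x2, y2, e2⟩ := down (by linarith [hs.1]) hss (by linarith [hs'.2]) ha' ha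
    obtain ⟨r₃, x3, y3, e3⟩ := up (by linarith [hs'.1]) hs'.2 h1 ha (by linarith)
    exact bad (by linarith) (by linarith) (by linarith) (by linarith) (by linarith)
      (by linarith) e1 e2 e3
  have m3 : AntitoneOn g (Icc t₁ T) := by
    intro s hs s' hs' hss
    by_contra! hlt
    obtain ⟨a, ha, ha'⟩ := exists_between hlt
    have b1 := (hr s ⟨by linarith [hs.1], hs.2⟩).1
    have b2 := (hr s' ⟨by linarith [hs'.1], hs'.2⟩).2
    obtain ⟨r₁, x1, y1, e1⟩ := up h0 h01 h1 (by linarith : g t₀ < a) (by linarith)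
    obtain ⟨r₂, x2, y2, e2⟩ := down (by linarith) hs.1 hs.2 (by linarith : a < g t₁) ha
    obtain ⟨r₃, x3, y3, e3⟩ := up (by linarith [hs.1]) hss hs'.2 ha ha'
    exact bad (by linarith) (by linarith) (by linarith) (by linarith) (by linarith)
      (by linarith [hs'.2]) e1 e2 e3
  have hsub : ∀ {p q : ℝ}, 0 ≤ p → p ≤ q → q ≤ T → IntervalIntegrable g' volume p q := by
    intro p q hp hpq hq
    refine hi.mono_set ?_
    rw [uIcc_of_le hpq, uIcc_of_le (by linarith)]
    exact Icc_subset_Icc hp hq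
  have i1 := hsub le_rfl h0 (h01.trans h1)
  have i2 := hsub h0 h01 h1
  have i3 := hsub (h0.trans h01) h1 le_rfl
  have e1 := integral_abs_deriv_of_antitoneOn h0 (hg.mono (Icc_subset_Icc le_rfl (by linarith))) hS
    (fun t ht => hd t ⟨⟨ht.1.1, by linarith [ht.1.2]⟩, ht.2⟩) i1 m1
  have e2 := integral_abs_deriv_of_monotoneOn h01 (hg.mono (Icc_subset_Icc h0 h1)) hS
    (fun t ht => hd t ⟨⟨by linarith [ht.1.1], by linarith [ht.1.2]⟩, ht.2⟩) i2 m2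
  have e3 := integral_abs_deriv_of_antitoneOn h1 (hg.mono (Icc_subset_Icc (by linarith) le_rfl)) hS
    (fun t ht => hd t ⟨⟨by linarith [ht.1.1], ht.1.2⟩, ht.2⟩) i3 m3
  rw [← intervalIntegral.integral_add_adjacent_intervals i1.abs (i2.abs.trans i3.abs),
    ← intervalIntegral.integral_add_adjacent_intervals i2.abs i3.abs, e1, e2, e3]
  linarith

/-- If a closed path `g` of real numbers takes each value strictly between its minimum and its
maximum at most twice, then its total variation is twice its oscillation. -/
theorem integral_abs_deriv_eq {g g' : ℝ → ℝ} {T t₀ t₁ : ℝ} (h0 : t₀ ∈ Icc 0 T)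
    (h1 : t₁ ∈ Icc 0 T) (hg : ContinuousOn g (Icc 0 T)) {S : Set ℝ} (hS : S.Countable)
    (hd : ∀ t ∈ Ioo 0 T \ S, HasDerivAt g (g' t) t) (hi : IntervalIntegrable g' volume 0 T)
    (hT : g 0 = g T) (hr : ∀ t ∈ Icc 0 T, g t ∈ Icc (g t₀) (g t₁))
    (hlevel : ∀ a ∈ Ioo (g t₀) (g t₁), ∀ r ∈ Ioo 0 T, ∀ s ∈ Ioo 0 T, ∀ t ∈ Ioo 0 T,
      r < s → s < t → g r = a → g s = a → g t = a → False) :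
    ∫ t in 0..T, |g' t| = 2 * (g t₁ - g t₀) := by
  rcases le_total t₀ t₁ with h | h
  · exact integral_abs_deriv_of_le h0.1 h h1.2 hg hS hd hi hT hr hlevel
  -- When the maximum comes first, passing to `-g` exchanges the two extrema.
  · have := integral_abs_deriv_of_le (g := -g) (g' := -g') h1.1 h h0.2 hg.neg hS
      (fun t ht => (hd t ht).neg) hi.neg (by simpa using hT)
      (fun t ht => ⟨by simpa using (hr t ht).2, by simpa using (hr t ht).1⟩)
      (fun a ha r hr s hs t ht hrs hst e1 e2 e3 =>
        hlevel (-a) ⟨by simpa [lt_neg] using ha.2, by simpa [neg_lt] using ha.1⟩ r hr s hs t ht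
          hrs hst (by simp [← e1]) (by simp [← e2]) (by simp [← e3]))
    simp only [Pi.neg_apply, abs_neg] at this
    rw [this]
    ring

/-! ### Averaging a tangent vector over all pencils -/

/-- The argument `φ - 2θ` sweeps one full period, so the phase `φ` does not matter. -/
theorem integral_abs_cos_period (φ : ℝ) :
    ∫ θ in (-(Real.pi / 2))..(Real.pi / 2), |Real.cos (φ - 2 * θ)| = 2 := by
  rw [intervalIntegral.integral_comp_sub_mul (fun x => |Real.cos x|) two_ne_zero]
  have hper : Function.Periodic (fun x => |Real.cos x|) (2 * Real.pi) := by
    intro x; simp [Real.cos_add_two_pi]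
  have e := hper.intervalIntegral_add_eq (φ - 2 * (Real.pi / 2)) (-(Real.pi / 2))
  rw [show φ - 2 * (Real.pi / 2) + 2 * Real.pi = φ - 2 * -(Real.pi / 2) by ring] at e
  rw [e]
  have hc : Continuous fun x => |Real.cos x| := by fun_prop
  rw [← intervalIntegral.integral_add_adjacent_intervals
    (hc.intervalIntegrable (-(Real.pi / 2)) (Real.pi / 2)) (hc.intervalIntegrable _ _)]
  have hpi := Real.pi_pos
  have a1 : ∫ x in (-(Real.pi / 2))..(Real.pi / 2), |Real.cos x| = 2 := by
    rw [intervalIntegral.integral_congr (g := Real.cos)]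
    · rw [integral_cos]; simp; norm_num
    · intro x hx
      rw [uIcc_of_le (by linarith)] at hx
      exact abs_of_nonneg (Real.cos_nonneg_of_mem_Icc hx)
  have a2 : ∫ x in (Real.pi / 2)..(-(Real.pi / 2) + 2 * Real.pi), |Real.cos x| = 2 := by
    have := intervalIntegral.integral_comp_add_right (a := -(Real.pi / 2)) (b := Real.pi / 2)
      (fun x => |Real.cos x|) Real.pi
    simp only [Real.cos_add_pi, abs_neg, a1] at this
    rw [show -(Real.pi / 2) + Real.pi = Real.pi / 2 by ring] at this
    rw [show -(Real.pi / 2) + 2 * Real.pi = Real.pi / 2 + Real.pi by ring, ← this]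
  rw [a1, a2]
  norm_num

/-- Substitute `u = x + y tan θ`, where `z = x + iy`. Then `z - u = i y e^{iθ} / cos θ`, and the
Jacobian `y / cos² θ` leaves `(‖w‖ / y) |cos (arg w - 2θ)|`, whose integral is independent of `arg
w`. -/
theorem lintegral_abs_re_div_sq (z : ℍ) (w : ℂ) :
    ∫⁻ u : ℝ, ENNReal.ofReal |(w / ((z : ℂ) - u) ^ 2).re| = ENNReal.ofReal (2 * (‖w‖ / z.im)) := by
  have hy := z.im_pos
  set s : Set ℝ := Ioo (-(Real.pi / 2)) (Real.pi / 2) with hs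
  have hcos : ∀ θ ∈ s, 0 < Real.cos θ := fun θ hθ => Real.cos_pos_of_mem_Ioo hθ
  have hderiv : ∀ θ ∈ s, HasDerivWithinAt (fun θ => z.re + z.im * Real.tan θ)
      (z.im * (1 / Real.cos θ ^ 2)) s θ := fun θ hθ =>
    (((Real.hasDerivAt_tan (hcos θ hθ).ne').const_mul z.im).const_add z.re).hasDerivWithinAt
  have hinj : InjOn (fun θ => z.re + z.im * Real.tan θ) s := by
    intro a ha b hb h
    exact Real.injOn_tan ha hb (mul_left_cancel₀ hy.ne' (add_left_cancel h))
  have himg : (fun θ => z.re + z.im * Real.tan θ) '' s = univ := by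
    refine eq_univ_of_forall fun u => ?_
    refine ⟨Real.arctan ((u - z.re) / z.im), Real.arctan_mem_Ioo _, ?_⟩
    simp only [Real.tan_arctan]
    field_simp
    ring
  have h1 := lintegral_image_eq_lintegral_abs_deriv_mul measurableSet_Ioo hderiv hinj
    (fun u : ℝ => ENNReal.ofReal |(w / ((z : ℂ) - u) ^ 2).re|)
  rw [himg, Measure.restrict_univ] at h1
  rw [h1]
  have h2 : ∀ θ ∈ s, ENNReal.ofReal |z.im * (1 / Real.cos θ ^ 2)| *
      ENNReal.ofReal |(w / ((z : ℂ) - (z.re + z.im * Real.tan θ : ℝ)) ^ 2).re| =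
      ENNReal.ofReal (‖w‖ / z.im * |Real.cos (w.arg - 2 * θ)|) := by
    intro θ hθ
    have hc := hcos θ hθ
    rw [← ENNReal.ofReal_mul (abs_nonneg _), ← abs_mul]
    congr 1
    -- The square of `i` contributes a minus sign, which is absorbed by the absolute value.
    rw [← abs_of_nonneg (show 0 ≤ ‖w‖ / z.im by positivity), ← abs_mul, ← abs_neg]
    congr 1
    have hw1 := Complex.norm_mul_cos_arg w
    have hw2 := Complex.norm_mul_sin_arg w
    have hz : (z : ℂ) - (z.re + z.im * Real.tan θ : ℝ) = ⟨-(z.im * Real.tan θ), z.im⟩ := by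
      apply Complex.ext
      · rw [Complex.sub_re, Complex.ofReal_re, UpperHalfPlane.coe_re]
        ring
      · rw [Complex.sub_im, Complex.ofReal_im, UpperHalfPlane.coe_im, sub_zero]
    rw [hz, Complex.div_re, Real.cos_sub,
      Real.cos_two_mul, Real.sin_two_mul, Real.tan_eq_sin_div_cos]
    have hsc := Real.sin_sq_add_cos_sq θ
    have hn : Complex.normSq (⟨-(z.im * (Real.sin θ / Real.cos θ)), z.im⟩ ^ 2) =
        (z.im ^ 2 / Real.cos θ ^ 2) ^ 2 := by
      rw [map_pow, Complex.normSq_apply]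
      congr 1
      simp only
      field_simp
      linear_combination hsc
    rw [hn]
    simp only [pow_two, Complex.mul_re, Complex.mul_im]
    have : ‖w‖ / z.im * (Real.cos w.arg * (2 * (Real.cos θ * Real.cos θ) - 1) +
        Real.sin w.arg * (2 * Real.sin θ * Real.cos θ)) =
        (w.re * (2 * (Real.cos θ * Real.cos θ) - 1) + w.im * (2 * Real.sin θ * Real.cos θ)) /
          z.im := by
      rw [← hw1, ← hw2]
      ring
    rw [this]
    field_simp
    linear_combination (- w.re) * hsc
  rw [setLIntegral_congr_fun measurableSet_Ioo h2]
  have hcont : Continuous fun θ => ‖w‖ / z.im * |Real.cos (w.arg - 2 * θ)| := by fun_prop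
  have hint : IntegrableOn (fun θ => ‖w‖ / z.im * |Real.cos (w.arg - 2 * θ)|) s :=
    (hcont.integrableOn_Icc (a := -(Real.pi / 2)) (b := Real.pi / 2)).mono_set Ioo_subset_Icc_self
  rw [← ofReal_integral_eq_lintegral_ofReal hint
    (Filter.Eventually.of_forall fun θ => by positivity)]
  congr 1
  rw [hs, ← integral_Ioc_eq_integral_Ioo,
    ← intervalIntegral.integral_of_le (by linarith [Real.pi_pos]),
    intervalIntegral.integral_const_mul, integral_abs_cos_period]
  ring

/-! ### The Crofton formula for a parametrized boundary -/

theorem coe_sub_ofReal_ne_zero (z : ℍ) (u : ℝ) : (z : ℂ) - u ≠ 0 := by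
  intro h
  have := congrArg Complex.im h
  simp [z.im_ne_zero] at this

theorem hasDerivAt_pencil_comp {c : ℝ → ℍ} {t : ℝ} {w : ℂ} (u : ℝ)
    (h : HasDerivAt (fun s => (c s : ℂ)) w t) :
    HasDerivAt (fun s => pencil u (c s)) (w / ((c t : ℂ) - u) ^ 2).re t := by
  have hne := coe_sub_ofReal_ne_zero (c t) u
  have h1 := ((h.sub_const (u : ℂ)).inv hne).neg
  have h2 := (Complex.reCLM.hasFDerivAt (x := -((c t : ℂ) - u)⁻¹)).comp_hasDerivAt t h1
  refine (h2.congr_deriv ?_).congr_of_eventuallyEq (.of_forall fun s => ?_)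
  · rw [Complex.reCLM_apply, neg_div, neg_neg]
  · simp [pencil_eq_re, neg_div]

theorem intervalIntegrable_speed {T : ℝ} {c : ℝ → ℍ} (hc : Continuous c)
    (hi : IntervalIntegrable (deriv fun s => (c s : ℂ)) volume 0 T) :
    IntervalIntegrable (fun t => ‖deriv (fun s => (c s : ℂ)) t‖ / (c t).im) volume 0 T := by
  have h : Continuous fun t => ((c t).im)⁻¹ :=
    (UpperHalfPlane.continuous_im.comp hc).inv₀ fun t => (c t).im_ne_zero
  simpa only [div_eq_mul_inv] using hi.norm.mul_continuousOn h.continuousOn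

/-- The oscillation of `pencil u` over a domain as an integral over its boundary. -/
theorem IsCompactConvexDomain.lintegral_boundary {D : Set ℍ} (hD : IsCompactConvexDomain D)
    {T : ℝ} (hT : 0 < T) {c : ℝ → ℍ} (hc : Continuous c) (hcT : c 0 = c T)
    (hinj : InjOn c (Ico 0 T)) (himg : c '' Icc 0 T = frontier D) {S : Set ℝ} (hS : S.Countable)
    (hd : ∀ t ∈ Ioo 0 T \ S, DifferentiableAt ℝ (fun s => (c s : ℂ)) t)
    (hi : IntervalIntegrable (deriv fun s => (c s : ℂ)) volume 0 T) {u : ℝ} {a b : ℍ}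
    (ha : a ∈ frontier D) (hb : b ∈ frontier D)
    (hab : pencil u '' D = Icc (pencil u a) (pencil u b)) :
    ∫⁻ t in Ioc 0 T, ENNReal.ofReal |(deriv (fun s => (c s : ℂ)) t / ((c t : ℂ) - u) ^ 2).re| =
      ENNReal.ofReal (2 * (pencil u b - pencil u a)) := by
  have hfD : frontier D ⊆ D := hD.isCompact.isClosed.frontier_subset
  obtain ⟨t₀, ht₀, rfl⟩ := himg.symm ▸ ha
  obtain ⟨t₁, ht₁, rfl⟩ := himg.symm ▸ hb
  have hcD : ∀ t ∈ Icc 0 T, c t ∈ frontier D := fun t ht => himg ▸ mem_image_of_mem c ht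
  have hcc : Continuous fun t => (c t : ℂ) := UpperHalfPlane.continuous_coe.comp hc
  have hg' : IntervalIntegrable
      (fun t => (deriv (fun s => (c s : ℂ)) t / ((c t : ℂ) - u) ^ 2).re) volume 0 T := by
    have h : Continuous fun t => (((c t : ℂ) - u) ^ 2)⁻¹ :=
      ((hcc.sub continuous_const).pow 2).inv₀ fun t => pow_ne_zero 2 (coe_sub_ofReal_ne_zero _ _)
    have h1 := hi.mul_continuousOn h.continuousOn
    rw [intervalIntegrable_iff] at h1 ⊢
    simp only [div_eq_mul_inv]
    exact h1.re
  rw [← integral_abs_deriv_eq (g := fun t => pencil u (c t)) ht₀ ht₁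
    ((continuous_pencil u).comp hc).continuousOn hS
    (fun t ht => hasDerivAt_pencil_comp u (hd t ht).hasDerivAt) hg' (by simp only [hcT])
    (fun t ht => hab ▸ mem_image_of_mem _ (hfD (hcD t ht))),
    intervalIntegral.integral_of_le hT.le, ofReal_integral_eq_lintegral_ofReal]
  · exact (intervalIntegrable_iff_integrableOn_Ioc_of_le hT.le).1 hg'.abs
  · exact .of_forall fun t => abs_nonneg _
  -- The three times lie in the open interval, so injectivity gives three distinct boundary points
  -- on one level.
  · intro x hx r hr s hs t ht hrs hst er es et
    have hne : ∀ {p q : ℝ}, p ∈ Ioo 0 T → q ∈ Ioo 0 T → p < q → c p ≠ c q :=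
      fun hp hq hpq h => hpq.ne (hinj (Ioo_subset_Ico_self hp) (Ioo_subset_Ico_self hq) h)
    have h1 := hne hr hs hrs
    have h2 := hne hs ht hst
    have h3 := hne hr ht (hrs.trans hst)
    refine hD.not_three_on_level (u := u) (a := x) (z := ![c r, c s, c t])
      (hfD (hcD t₀ ht₀)) (hfD (hcD t₁ ht₁)) hx.1 hx.2 ?_ ?_ ?_
    · intro i j hij
      fin_cases i <;> fin_cases j <;> simp [h1, h2, h3, h1.symm, h2.symm, h3.symm] at hij ⊢
    · intro i
      fin_cases i
      · exact hcD r (Ioo_subset_Icc_self hr)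
      · exact hcD s (Ioo_subset_Icc_self hs)
      · exact hcD t (Ioo_subset_Icc_self ht)
    · intro i
      fin_cases i
      · exact er
      · exact es
      · exact et

/-- The Crofton formula for a convex domain whose boundary is parametrized by a closed curve that
is differentiable off a countable set. -/
theorem IsCompactConvexDomain.liouville_eq {D : Set ℍ} (hD : IsCompactConvexDomain D)
    {T : ℝ} (hT : 0 < T) {c : ℝ → ℍ} (hc : Continuous c) (hcT : c 0 = c T)
    (hinj : InjOn c (Ico 0 T)) (himg : c '' Icc 0 T = frontier D) {S : Set ℝ} (hS : S.Countable)
    (hd : ∀ t ∈ Ioo 0 T \ S, DifferentiableAt ℝ (fun s => (c s : ℂ)) t)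
    (hi : IntervalIntegrable (deriv fun s => (c s : ℂ)) volume 0 T) :
    liouville (geodesicsMeeting D) = ENNReal.ofReal (curveLength T c / 2) := by
  choose a ha b hb _ hab using hD.exists_pencil_image
  have hcc : Continuous fun t => (c t : ℂ) := UpperHalfPlane.continuous_coe.comp hc
  have hmeas : Measurable (Function.uncurry fun (u t : ℝ) =>
      ENNReal.ofReal |(deriv (fun s => (c s : ℂ)) t / ((c t : ℂ) - u) ^ 2).re|) := by
    have h1 : Measurable fun p : ℝ × ℝ => deriv (fun s => (c s : ℂ)) p.2 :=
      (measurable_deriv _).comp measurable_snd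
    have h2 : Measurable fun p : ℝ × ℝ => (c p.2 : ℂ) := hcc.measurable.comp measurable_snd
    have h3 : Measurable fun p : ℝ × ℝ => (p.1 : ℂ) :=
      Complex.measurable_ofReal.comp measurable_fst
    exact (Complex.measurable_re.comp (h1.div ((h2.sub h3).pow_const 2))).abs.ennreal_ofReal
  -- One factor 2 comes from ordering the endpoints, the other from total variation being twice the
  -- oscillation.
  have h4 : 2 * (2 * liouville (geodesicsMeeting D)) = ENNReal.ofReal (2 * curveLength T c) := by
    rw [two_mul_liouville_eq_lintegral hD.isCompact hab, ← lintegral_const_mul' _ _ (by simp)]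
    calc ∫⁻ u, 2 * ENNReal.ofReal (pencil u (b u) - pencil u (a u))
        = ∫⁻ u : ℝ, ∫⁻ t in Ioc 0 T,
            ENNReal.ofReal |(deriv (fun s => (c s : ℂ)) t / ((c t : ℂ) - u) ^ 2).re| := by
          refine lintegral_congr fun u => ?_
          rw [hD.lintegral_boundary hT hc hcT hinj himg hS hd hi (ha u) (hb u) (hab u),
            ENNReal.ofReal_mul (by norm_num)]
          simp
      _ = ∫⁻ t in Ioc 0 T, ∫⁻ u : ℝ,
            ENNReal.ofReal |(deriv (fun s => (c s : ℂ)) t / ((c t : ℂ) - u) ^ 2).re| :=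
          lintegral_lintegral_swap hmeas.aemeasurable
      _ = ∫⁻ t in Ioc 0 T, ENNReal.ofReal (2 * (‖deriv (fun s => (c s : ℂ)) t‖ / (c t).im)) :=
          lintegral_congr fun t => lintegral_abs_re_div_sq (c t) _
      _ = ENNReal.ofReal (2 * curveLength T c) := by
          rw [curveLength, ← intervalIntegral.integral_const_mul,
            intervalIntegral.integral_of_le hT.le, ofReal_integral_eq_lintegral_ofReal]
          · exact (intervalIntegrable_iff_integrableOn_Ioc_of_le hT.le).1
              ((intervalIntegrable_speed hc hi).const_mul 2)
          · refine .of_forall fun t => ?_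
            have := (c t).im_pos
            positivity
  have h5 : ENNReal.ofReal (2 * curveLength T c) =
      2 * (2 * ENNReal.ofReal (curveLength T c / 2)) := by
    rw [show 2 * curveLength T c = 2 * (2 * (curveLength T c / 2)) by ring,
      ENNReal.ofReal_mul (by norm_num), ENNReal.ofReal_mul (by norm_num)]
    simp
  rw [h5] at h4
  exact (ENNReal.mul_right_inj two_ne_zero ENNReal.ofNat_ne_top).1
    ((ENNReal.mul_right_inj two_ne_zero ENNReal.ofNat_ne_top).1 h4)

theorem IsCompactConvexDomain.liouville_eq_of_C1 {D : Set ℍ} (hD : IsCompactConvexDomain D)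
    {T : ℝ} {c : ℝ → ℍ} (hc : IsSimpleClosedC1Curve T c (frontier D)) :
    liouville (geodesicsMeeting D) = ENNReal.ofReal (curveLength T c / 2) := by
  have hcont : Continuous c := by
    rw [UpperHalfPlane.isEmbedding_coe.continuous_iff]
    exact hc.contDiff.continuous
  have hcT : c 0 = c T := by simpa using (hc.periodic 0).symm
  refine hD.liouville_eq hc.pos hcont hcT hc.injOn ?_ countable_empty
    (fun t _ => (hc.contDiff.differentiable one_ne_zero) t)
    ((hc.contDiff.continuous_deriv le_rfl).intervalIntegrable _ _)
  rw [← hc.image_eq, ← Ico_insert_right hc.pos.le, image_insert_eq, insert_eq_of_mem]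
  exact ⟨0, ⟨le_rfl, hc.pos⟩, hcT⟩

/-! ### The length of a geodesic segment -/

/-- A curve along which distances add up has metric speed `‖w‖ / im`. -/
theorem hasDerivAt_of_sub_eq_dist {c : ℝ → ℍ} {φ : ℝ → ℝ} {t : ℝ} {w : ℂ}
    (hc : HasDerivAt (fun s => (c s : ℂ)) w t)
    (hgt : ∀ᶠ s in nhds t, t < s → φ s - φ t = dist (c s) (c t))
    (hlt : ∀ᶠ s in nhds t, s < t → φ s - φ t = -dist (c s) (c t)) :
    HasDerivAt φ (‖w‖ / (c t).im) t := by
  -- Chosen so that `dist (c s) (c t) = 2 arsinh (|s - t| m s)` for `s ≠ t`. As `arsinh` is odd, `φ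
  -- s = φ t + 2 arsinh ((s - t) m s)` holds on both sides of `t`.
  set m : ℝ → ℝ := fun s =>
    ‖slope (fun s => (c s : ℂ)) t s‖ / (2 * √((c s).im * (c t).im)) with hm
  have him : ContinuousAt (fun s => (c s).im) t :=
    Complex.continuous_im.continuousAt.comp hc.continuousAt
  have hpos := (c t).im_pos
  have hlim : Filter.Tendsto m (nhdsWithin t {t}ᶜ) (nhds (‖w‖ / (2 * (c t).im))) := by
    have h1 := (hasDerivAt_iff_tendsto_slope.1 hc).norm
    have h2 : Filter.Tendsto (fun s => 2 * √((c s).im * (c t).im)) (nhdsWithin t {t}ᶜ)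
        (nhds (2 * √((c t).im * (c t).im))) :=
      ((Real.continuous_sqrt.continuousAt.tendsto.comp
        (him.tendsto.mul_const (c t).im)).const_mul 2).mono_left nhdsWithin_le_nhds
    rw [Real.sqrt_mul_self hpos.le] at h2
    exact h1.div h2 (by positivity)
  -- Only the limit of `m` over `s ≠ t` enters, so the default value of the slope at `t` is
  -- harmless.
  have hG : HasDerivAt (fun s => (s - t) * m s) (‖w‖ / (2 * (c t).im)) t := by
    rw [hasDerivAt_iff_tendsto_slope]
    refine hlim.congr' ?_
    filter_upwards [self_mem_nhdsWithin] with s hs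
    have hst : s - t ≠ 0 := sub_ne_zero.2 hs
    rw [slope_def_field]
    simp only [sub_self, zero_mul, sub_zero]
    rw [mul_div_cancel_left₀ _ hst]
  have hF := (((Real.hasDerivAt_arsinh ((t - t) * m t)).comp t hG).const_mul 2).add_const (φ t)
  have hnorm : ∀ s, ‖slope (fun s => (c s : ℂ)) t s‖ = dist (c s : ℂ) (c t) / |s - t| := by
    intro s
    rw [slope_def_module, norm_smul, norm_inv, Real.norm_eq_abs, Complex.dist_eq]
    ring
  refine (hF.congr_deriv ?_).congr_of_eventuallyEq ?_
  · simp
    field_simp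
  · filter_upwards [hgt, hlt] with s h1 h2
    simp only [Function.comp_apply, hm, hnorm]
    rcases lt_trichotomy s t with h | h | h
    · have hn : s - t < 0 := sub_neg.2 h
      have e : (s - t) * (dist (c s : ℂ) (c t) / |s - t| / (2 * √((c s).im * (c t).im))) =
          -(dist (c s : ℂ) (c t) / (2 * √((c s).im * (c t).im))) := by
        have hn0 := hn.ne
        rw [abs_of_neg hn]
        field_simp
      rw [e, Real.arsinh_neg]
      have := h2 h
      rw [UpperHalfPlane.dist_eq] at this
      linarith
    · subst h; simp
    · have hn : 0 < s - t := sub_pos.2 h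
      have e : (s - t) * (dist (c s : ℂ) (c t) / |s - t| / (2 * √((c s).im * (c t).im))) =
          dist (c s : ℂ) (c t) / (2 * √((c s).im * (c t).im)) := by
        rw [abs_of_pos hn]
        field_simp
      rw [e]
      have := h1 h
      rw [UpperHalfPlane.dist_eq] at this
      linarith

/-- The geodesic segment from `x` to `y`, parametrized affinely in the projective model. -/
def edge (x y : ℍ) (s : ℝ) : ℍ := ofKlein (klein x + s • (klein y - klein x))

/-- The parameters for which `edge x y` is a genuine point of the geodesic. -/
def edgeDomain (x y : ℍ) : Set ℝ := {s | klein x + s • (klein y - klein x) ∈ kleinRegion}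

theorem isOpen_edgeDomain (x y : ℍ) : IsOpen (edgeDomain x y) :=
  isOpen_kleinRegion.preimage (by fun_prop)

theorem mem_segment_of_mem_Icc (x y : ℍ) {s : ℝ} (hs : s ∈ Icc (0 : ℝ) 1) :
    klein x + s • (klein y - klein x) ∈ segment ℝ (klein x) (klein y) := by
  rw [segment_eq_image']
  exact ⟨s, hs, rfl⟩

theorem Icc_subset_edgeDomain (x y : ℍ) : Icc 0 1 ⊆ edgeDomain x y := fun _ hs =>
  segment_subset_range (mem_segment_of_mem_Icc x y hs)

theorem klein_edge {x y : ℍ} {s : ℝ} (hs : s ∈ edgeDomain x y) :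
    klein (edge x y s) = klein x + s • (klein y - klein x) :=
  klein_ofKlein hs

theorem edge_zero (x y : ℍ) : edge x y 0 = x := by simp [edge, ofKlein_klein]

theorem edge_one (x y : ℍ) : edge x y 1 = y := by simp [edge, ofKlein_klein]

theorem contDiffOn_edge (x y : ℍ) :
    ContDiffOn ℝ 1 (fun s => (edge x y s : ℂ)) (edgeDomain x y) := by
  set X : ℝ → ℝ := fun s => (klein x).1 + s * ((klein y).1 - (klein x).1) with hX
  set Y : ℝ → ℝ := fun s => (klein x).2 + s * ((klein y).2 - (klein x).2) with hY
  have h1 : ContDiffOn ℝ 1 (fun s => √(Y s - X s ^ 2)) (edgeDomain x y) := by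
    refine ContDiffOn.sqrt (by fun_prop) fun s hs => ?_
    have hs : X s ^ 2 < Y s := hs
    exact (sub_pos.2 hs).ne'
  have h2 : ContDiffOn ℝ 1 (fun s => ((X s : ℝ) : ℂ) + ((√(Y s - X s ^ 2) : ℝ) : ℂ) * Complex.I)
      (edgeDomain x y) := by
    have hX1 : ContDiffOn ℝ 1 X (edgeDomain x y) := by fun_prop
    exact (Complex.ofRealCLM.contDiff.comp_contDiffOn hX1).add
      ((Complex.ofRealCLM.contDiff.comp_contDiffOn h1).mul contDiffOn_const)
  refine h2.congr fun s hs => ?_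
  rw [edge, coe_ofKlein hs]
  apply Complex.ext <;> simp [hX, hY]

theorem continuousOn_deriv_edge (x y : ℍ) :
    ContinuousOn (deriv fun s => (edge x y s : ℂ)) (Icc 0 1) :=
  ((contDiffOn_edge x y).continuousOn_deriv_of_isOpen (isOpen_edgeDomain x y) le_rfl).mono
    (Icc_subset_edgeDomain x y)

/-- The edge extends past both vertices inside the open set `edgeDomain`, so the derivative is
two-sided also at `0` and `1`. -/
theorem differentiableAt_edge {x y : ℍ} {s : ℝ} (hs : s ∈ Icc (0 : ℝ) 1) :
    DifferentiableAt ℝ (fun s => (edge x y s : ℂ)) s :=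
  ((contDiffOn_edge x y).differentiableOn one_ne_zero).differentiableAt
    ((isOpen_edgeDomain x y).mem_nhds (Icc_subset_edgeDomain x y hs))

theorem continuousOn_edge (x y : ℍ) : ContinuousOn (edge x y) (Icc 0 1) := by
  rw [UpperHalfPlane.isEmbedding_coe.continuousOn_iff]
  exact (contDiffOn_edge x y).continuousOn.mono (Icc_subset_edgeDomain x y)

theorem dist_edge_add_dist_edge (x y : ℍ) {s t : ℝ} (hs : 0 ≤ s) (hst : s ≤ t) (ht : t ≤ 1) :
    dist x (edge x y s) + dist (edge x y s) (edge x y t) = dist x (edge x y t) := by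
  apply dist_add_dist_of_mem_segment
  rw [klein_edge (Icc_subset_edgeDomain x y ⟨hs, hst.trans ht⟩),
    klein_edge (Icc_subset_edgeDomain x y ⟨hs.trans hst, ht⟩), segment_eq_image']
  rcases eq_or_lt_of_le (hs.trans hst) with h | h
  · obtain rfl : s = 0 := by linarith
    exact ⟨0, by simp⟩
  · refine ⟨s / t, ⟨by positivity, (div_le_one h).2 hst⟩, ?_⟩
    simp only [add_sub_cancel_left, smul_smul]
    rw [div_mul_cancel₀ _ h.ne']

/-- Distances from `x` add up along the edge, so `dist x (edge x y s)` has derivative equal to the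
hyperbolic speed. The fundamental theorem of calculus gives the length. -/
theorem integral_speed_edge (x y : ℍ) :
    ∫ s in (0 : ℝ)..1, ‖deriv (fun s => (edge x y s : ℂ)) s‖ / (edge x y s).im = dist x y := by
  have h := intervalIntegral.integral_eq_sub_of_hasDerivAt_of_le (zero_le_one' ℝ)
    (f := fun s => dist x (edge x y s))
    (f' := fun s => ‖deriv (fun s => (edge x y s : ℂ)) s‖ / (edge x y s).im) ?_ ?_ ?_
  · simpa [edge_zero, edge_one] using h
  · exact (continuous_const.dist continuous_id).comp_continuousOn (continuousOn_edge x y)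
  · intro t ht
    refine hasDerivAt_of_sub_eq_dist (differentiableAt_edge (Ioo_subset_Icc_self ht)).hasDerivAt
      ?_ ?_
    · filter_upwards [Ioo_mem_nhds ht.1 ht.2] with s hs hts
      rw [← dist_edge_add_dist_edge x y ht.1.le hts.le hs.2.le, dist_comm (edge x y s)]
      ring
    · filter_upwards [Ioo_mem_nhds ht.1 ht.2] with s hs hts
      rw [← dist_edge_add_dist_edge x y hs.1.le hts.le ht.2.le]
      ring
  · apply ContinuousOn.intervalIntegrable
    rw [uIcc_of_le zero_le_one]
    exact (continuousOn_deriv_edge x y).norm.div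
      (UpperHalfPlane.continuous_im.comp_continuousOn (continuousOn_edge x y))
      fun s _ => (edge x y s).im_ne_zero

/-! ### Polygons as closed curves -/

/-- The piecewise affine path through `q 0, …, q n` with `q k` at time `k`. -/
def polyPath (q : ℕ → ℝ × ℝ) (n : ℕ) (t : ℝ) : ℝ × ℝ :=
  q 0 + ∑ i ∈ Finset.range n, max 0 (min (t - i) 1) • (q (i + 1) - q i)

theorem continuous_polyPath (q : ℕ → ℝ × ℝ) (n : ℕ) : Continuous (polyPath q n) := by
  unfold polyPath
  fun_prop

theorem polyPath_of_nonpos (q : ℕ → ℝ × ℝ) (n : ℕ) {t : ℝ} (ht : t ≤ 0) :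
    polyPath q n t = q 0 := by
  rw [polyPath, Finset.sum_eq_zero, add_zero]
  intro i _
  have : min (t - i) 1 ≤ 0 := (min_le_left _ _).trans (by linarith [i.cast_nonneg (α := ℝ)])
  rw [max_eq_left this, zero_smul]

theorem polyPath_of_ge (q : ℕ → ℝ × ℝ) (n : ℕ) {t : ℝ} (ht : n ≤ t) : polyPath q n t = q n := by
  have h : ∀ i ∈ Finset.range n, max 0 (min (t - i) 1) • (q (i + 1) - q i) = q (i + 1) - q i := by
    intro i hi
    have hi : (i : ℝ) + 1 ≤ n := by exact_mod_cast Finset.mem_range.1 hi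
    rw [min_eq_right (by linarith), max_eq_right zero_le_one, one_smul]
  rw [polyPath, Finset.sum_congr rfl h, Finset.sum_range_sub, add_sub_cancel]

/-- On this interval the earlier increments are saturated at weight 1 and telescope to `q k`, while
the later ones have weight 0. -/
theorem polyPath_of_mem (q : ℕ → ℝ × ℝ) {n k : ℕ} (hk : k < n) {t : ℝ}
    (ht : t ∈ Icc (k : ℝ) (k + 1)) : polyPath q n t = q k + (t - k) • (q (k + 1) - q k) := by
  induction n, hk using Nat.le_induction with
  | base =>
    have h := polyPath_of_ge q k ht.1
    rw [polyPath] at h ⊢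
    rw [Finset.sum_range_succ, ← add_assoc, h, min_eq_left (by linarith [ht.2]),
      max_eq_right (by linarith [ht.1])]
  | succ m hm ih =>
    rw [polyPath] at ih ⊢
    have hm : (k : ℝ) + 1 ≤ m := by exact_mod_cast hm
    rw [Finset.sum_range_succ, ← add_assoc, ih, max_eq_left, zero_smul, add_zero]
    exact (min_le_left _ _).trans (by linarith [ht.2])

/-- The closed curve through the points `P 0, …, P n`, where `P k` is reached at time `k`. -/
def polyCurve (P : ℕ → ℍ) (n : ℕ) (t : ℝ) : ℍ := ofKlein (polyPath (fun k => klein (P k)) n t)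

theorem polyCurve_of_mem (P : ℕ → ℍ) {n k : ℕ} (hk : k < n) {t : ℝ}
    (ht : t ∈ Icc (k : ℝ) (k + 1)) : polyCurve P n t = edge (P k) (P (k + 1)) (t - k) := by
  rw [polyCurve, polyPath_of_mem _ hk ht, edge]

theorem sub_mem_Icc_zero_one {k t : ℝ} (ht : t ∈ Icc k (k + 1)) : t - k ∈ Icc (0 : ℝ) 1 :=
  ⟨sub_nonneg.2 ht.1, by linarith [ht.2]⟩

theorem floor_mem {n : ℕ} {t : ℝ} (h0 : 0 ≤ t) (hn : t < n) :
    ⌊t⌋₊ < n ∧ t ∈ Ico (⌊t⌋₊ : ℝ) (⌊t⌋₊ + 1) :=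
  ⟨(Nat.floor_lt h0).2 hn, Nat.floor_le h0, Nat.lt_floor_add_one t⟩

/-- The path is constant outside `[0, n]`, so it never leaves the region and `polyCurve` is
continuous on the whole line. -/
theorem polyPath_mem_kleinRegion (P : ℕ → ℍ) (n : ℕ) (t : ℝ) :
    polyPath (fun k => klein (P k)) n t ∈ kleinRegion := by
  rcases le_or_gt t 0 with h0 | h0
  · rw [polyPath_of_nonpos _ _ h0]
    exact klein_mem _
  rcases le_or_gt (n : ℝ) t with hn | hn
  · rw [polyPath_of_ge _ _ hn]
    exact klein_mem _
  obtain ⟨hk, ht⟩ := floor_mem h0.le hn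
  have ht := Ico_subset_Icc_self ht
  rw [polyPath_of_mem _ hk ht]
  exact Icc_subset_edgeDomain _ _ (sub_mem_Icc_zero_one ht)

theorem continuous_polyCurve (P : ℕ → ℍ) (n : ℕ) : Continuous (polyCurve P n) :=
  continuousOn_ofKlein.comp_continuous (continuous_polyPath _ n) (polyPath_mem_kleinRegion P n)

theorem polyCurve_zero (P : ℕ → ℍ) (n : ℕ) : polyCurve P n 0 = P 0 := by
  rw [polyCurve, polyPath_of_nonpos _ _ le_rfl, ofKlein_klein]

theorem polyCurve_nat (P : ℕ → ℍ) (n : ℕ) : polyCurve P n n = P n := by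
  rw [polyCurve, polyPath_of_ge _ _ le_rfl, ofKlein_klein]

theorem edge_mem_geodesicSegment (x y : ℍ) {s : ℝ} (hs : s ∈ Icc (0 : ℝ) 1) :
    edge x y s ∈ geodesicSegment x y := by
  rw [geodesicSegment_eq, mem_preimage, klein_edge (Icc_subset_edgeDomain x y hs)]
  exact mem_segment_of_mem_Icc x y hs

theorem geodesicSegment_eq_image (x y : ℍ) : geodesicSegment x y = edge x y '' Icc 0 1 := by
  apply Subset.antisymm
  · intro z hz
    rw [geodesicSegment_eq, mem_preimage, segment_eq_image'] at hz
    obtain ⟨s, hs, e⟩ := hz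
    refine ⟨s, hs, klein_injective ?_⟩
    rw [klein_edge (Icc_subset_edgeDomain x y hs), ← e]
  · rintro _ ⟨s, hs, rfl⟩
    exact edge_mem_geodesicSegment x y hs

theorem injOn_edge {x y : ℍ} (hxy : x ≠ y) : InjOn (edge x y) (Icc 0 1) := by
  intro s hs t ht h
  have h := congrArg klein h
  rw [klein_edge (Icc_subset_edgeDomain x y hs), klein_edge (Icc_subset_edgeDomain x y ht)] at h
  exact smul_left_injective ℝ (sub_ne_zero.2 fun h => hxy (klein_injective h).symm)
    (add_left_cancel h)

/-! ### Image, injectivity and length of the polygonal curve -/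

section Curve

variable {P : ℕ → ℍ} {n : ℕ}

theorem image_polyCurve (hn : 0 < n) :
    polyCurve P n '' Icc 0 n = ⋃ k ∈ Finset.range n, geodesicSegment (P k) (P (k + 1)) := by
  have hcover : Icc (0 : ℝ) n = ⋃ k ∈ Finset.range n, Icc (k : ℝ) (k + 1) := by
    ext t
    simp only [mem_iUnion, Finset.mem_range, exists_prop]
    constructor
    · intro ht
      rcases eq_or_lt_of_le ht.2 with h | h
      -- The final time `n` belongs to the last edge, whereas its floor would point past it.
      · refine ⟨n - 1, by omega, ?_⟩
        rw [Nat.cast_sub hn, h]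
        constructor <;> simp
      · obtain ⟨hk, h'⟩ := floor_mem ht.1 h
        exact ⟨_, hk, Ico_subset_Icc_self h'⟩
    · rintro ⟨k, hk, ht⟩
      have hk : (k : ℝ) + 1 ≤ n := by exact_mod_cast hk
      exact ⟨k.cast_nonneg.trans ht.1, ht.2.trans hk⟩
  rw [hcover, image_iUnion₂]
  refine iUnion₂_congr fun k hk => ?_
  rw [geodesicSegment_eq_image]
  have hk := Finset.mem_range.1 hk
  ext z
  constructor
  · rintro ⟨t, ht, rfl⟩
    exact ⟨t - k, sub_mem_Icc_zero_one ht, (polyCurve_of_mem P hk ht).symm⟩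
  · rintro ⟨s, hs, rfl⟩
    have hs' : k + s ∈ Icc (k : ℝ) (k + 1) := ⟨by linarith [hs.1], by linarith [hs.2]⟩
    exact ⟨k + s, hs', by rw [polyCurve_of_mem P hk hs', add_sub_cancel_left]⟩

/-- Times in `[k, k + 1)` trace an edge without its final vertex, and these half-open edges are
pairwise disjoint. -/
theorem injOn_polyCurve (hne : ∀ k < n, P k ≠ P (k + 1))
    (hsimple : ∀ k < n, ∀ l < n, k ≠ l → Disjoint
      (geodesicSegment (P k) (P (k + 1)) \ {P (k + 1)})
      (geodesicSegment (P l) (P (l + 1)) \ {P (l + 1)})) :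
    InjOn (polyCurve P n) (Ico 0 n) := by
  have hmem : ∀ t ∈ Ico (0 : ℝ) n, polyCurve P n t ∈
      geodesicSegment (P ⌊t⌋₊) (P (⌊t⌋₊ + 1)) \ {P (⌊t⌋₊ + 1)} := by
    intro t ht
    obtain ⟨hk, ht'⟩ := floor_mem ht.1 ht.2
    have hI := sub_mem_Icc_zero_one (Ico_subset_Icc_self ht')
    rw [polyCurve_of_mem P hk (Ico_subset_Icc_self ht')]
    refine ⟨edge_mem_geodesicSegment _ _ hI, fun h => ?_⟩
    have := injOn_edge (hne _ hk) hI ⟨zero_le_one, le_rfl⟩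
      ((mem_singleton_iff.1 h).trans (edge_one _ _).symm)
    linarith [ht'.2]
  intro s hs t ht h
  obtain ⟨hk, hs'⟩ := floor_mem hs.1 hs.2
  obtain ⟨hl, ht'⟩ := floor_mem ht.1 ht.2
  by_cases hkl : ⌊s⌋₊ = ⌊t⌋₊
  · rw [polyCurve_of_mem P hk (Ico_subset_Icc_self hs'),
      polyCurve_of_mem P hl (Ico_subset_Icc_self ht'), ← hkl] at h
    rw [← hkl] at ht'
    have := injOn_edge (hne _ hk) (sub_mem_Icc_zero_one (Ico_subset_Icc_self hs'))
      (sub_mem_Icc_zero_one (Ico_subset_Icc_self ht')) h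
    linarith
  · exact absurd (h ▸ hmem t ht) (disjoint_left.1 (hsimple _ hk _ hl hkl) (hmem s hs))

theorem polyCurve_eventuallyEq {k : ℕ} (hk : k < n) {t : ℝ} (ht : t ∈ Ioo (k : ℝ) (k + 1)) :
    (fun s => (polyCurve P n s : ℂ)) =ᶠ[nhds t]
      fun s => (edge (P k) (P (k + 1)) (s - k) : ℂ) := by
  filter_upwards [Ioo_mem_nhds ht.1 ht.2] with s hs
  rw [polyCurve_of_mem P hk (Ioo_subset_Icc_self hs)]

theorem deriv_polyCurve {k : ℕ} (hk : k < n) {t : ℝ} (ht : t ∈ Ioo (k : ℝ) (k + 1)) :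
    deriv (fun s => (polyCurve P n s : ℂ)) t =
      deriv (fun s => (edge (P k) (P (k + 1)) s : ℂ)) (t - k) := by
  rw [(polyCurve_eventuallyEq hk ht).deriv_eq]
  exact deriv_comp_sub_const (f := fun s => (edge (P k) (P (k + 1)) s : ℂ)) (a := (k : ℝ)) (x := t)

theorem differentiableAt_polyCurve {t : ℝ} (ht : t ∈ Ioo (0 : ℝ) n \ range ((↑) : ℕ → ℝ)) :
    DifferentiableAt ℝ (fun s => (polyCurve P n s : ℂ)) t := by
  obtain ⟨hk, ht'⟩ := floor_mem ht.1.1.le ht.1.2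
  have hI := sub_mem_Icc_zero_one (Ico_subset_Icc_self ht')
  have ht'' : t ∈ Ioo (⌊t⌋₊ : ℝ) (⌊t⌋₊ + 1) :=
    ⟨lt_of_le_of_ne ht'.1 fun h => ht.2 ⟨_, h⟩, ht'.2⟩
  refine DifferentiableAt.congr_of_eventuallyEq ?_ (polyCurve_eventuallyEq hk ht'')
  exact DifferentiableAt.comp (g := fun s => (edge (P ⌊t⌋₊) (P (⌊t⌋₊ + 1)) s : ℂ)) t
    (differentiableAt_edge hI) (differentiableAt_id.sub_const (⌊t⌋₊ : ℝ))

theorem intervalIntegrable_deriv_polyCurve_piece {k : ℕ} (hk : k < n) :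
    IntervalIntegrable (deriv fun s => (polyCurve P n s : ℂ)) volume (k : ℝ) ((k + 1 : ℕ) : ℝ) := by
  push_cast
  rw [intervalIntegrable_iff_integrableOn_Ioo_of_le (by linarith)]
  have h : ContinuousOn (fun t : ℝ => deriv (fun s => (edge (P k) (P (k + 1)) s : ℂ)) (t - k))
      (Icc (k : ℝ) (k + 1)) :=
    (continuousOn_deriv_edge _ _).comp (by fun_prop) fun t ht => sub_mem_Icc_zero_one ht
  exact (h.integrableOn_Icc.mono_set Ioo_subset_Icc_self).congr_fun
    (fun t ht => (deriv_polyCurve hk ht).symm) measurableSet_Ioo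

theorem intervalIntegrable_deriv_polyCurve :
    IntervalIntegrable (deriv fun s => (polyCurve P n s : ℂ)) volume 0 n := by
  have h := IntervalIntegrable.trans_iterate (a := fun k : ℕ => (k : ℝ)) (n := n)
    (f := deriv fun s => (polyCurve P n s : ℂ)) (μ := volume)
    fun k hk => intervalIntegrable_deriv_polyCurve_piece hk
  simpa using h

theorem integral_speed_polyCurve_piece {k : ℕ} (hk : k < n) :
    ∫ t in (k : ℝ)..((k + 1 : ℕ) : ℝ),
      ‖deriv (fun s => (polyCurve P n s : ℂ)) t‖ / (polyCurve P n t).im =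
        dist (P k) (P (k + 1)) := by
  rw [← integral_speed_edge]
  have h := intervalIntegral.integral_comp_sub_right (a := (k : ℝ)) (b := ((k + 1 : ℕ) : ℝ))
    (fun s => ‖deriv (fun s => (edge (P k) (P (k + 1)) s : ℂ)) s‖ /
      (edge (P k) (P (k + 1)) s).im) (k : ℝ)
  rw [sub_self, show ((k + 1 : ℕ) : ℝ) - k = 1 by push_cast; ring] at h
  rw [← h]
  push_cast
  have hle : (k : ℝ) ≤ k + 1 := by linarith
  rw [intervalIntegral.integral_of_le hle, intervalIntegral.integral_of_le hle,
    integral_Ioc_eq_integral_Ioo, integral_Ioc_eq_integral_Ioo]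
  refine setIntegral_congr_fun measurableSet_Ioo fun t ht => ?_
  rw [deriv_polyCurve hk ht, polyCurve_of_mem P hk (Ioo_subset_Icc_self ht)]

theorem curveLength_polyCurve :
    curveLength n (polyCurve P n) = ∑ k ∈ Finset.range n, dist (P k) (P (k + 1)) := by
  have hc : Continuous fun t => ((polyCurve P n t).im)⁻¹ :=
    (UpperHalfPlane.continuous_im.comp (continuous_polyCurve P n)).inv₀
      fun t => UpperHalfPlane.im_ne_zero _
  have h := intervalIntegral.sum_integral_adjacent_intervals (a := fun k : ℕ => (k : ℝ)) (n := n)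
    (f := fun t => ‖deriv (fun s => (polyCurve P n s : ℂ)) t‖ / (polyCurve P n t).im)
    (μ := volume) fun k hk => by
      simpa only [div_eq_mul_inv] using
        (intervalIntegrable_deriv_polyCurve_piece hk).norm.mul_continuousOn hc.continuousOn
  rw [curveLength]
  simp only [Nat.cast_zero] at h
  rw [← h]
  exact Finset.sum_congr rfl fun k hk => integral_speed_polyCurve_piece (Finset.mem_range.1 hk)

end Curve

theorem IsCompactConvexDomain.liouville_eq_of_polygon {D : Set ℍ} (hD : IsCompactConvexDomain D)
    {n : ℕ} [NeZero n] {p : Fin n → ℍ} (hp : IsSimplePolygon p (frontier D)) :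
    liouville (geodesicsMeeting D) = ENNReal.ofReal (polygonLength p / 2) := by
  have hn : 0 < n := NeZero.pos n
  -- `Fin.ofNat` reduces modulo `n`, so `P n = P 0` and the curve closes up.
  set P : ℕ → ℍ := fun k => p (Fin.ofNat n k) with hP
  have hsucc : ∀ k, Fin.ofNat n (k + 1) = Fin.ofNat n k + 1 := by
    intro k
    ext
    simp [Fin.val_add]
  have hcast : ∀ i : Fin n, Fin.ofNat n i = i := fun i => by simp
  have hlen : curveLength n (polyCurve P n) = polygonLength p := by
    rw [curveLength_polyCurve, polygonLength, Finset.sum_range]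
    refine Finset.sum_congr rfl fun i _ => ?_
    simp only [hP, hsucc, hcast]
  rw [← hlen]
  refine hD.liouville_eq (by exact_mod_cast hn) (continuous_polyCurve P n) ?_
    (injOn_polyCurve ?_ ?_) ?_ (countable_range ((↑) : ℕ → ℝ))
    (fun t ht => differentiableAt_polyCurve ht) intervalIntegrable_deriv_polyCurve
  · rw [polyCurve_zero, polyCurve_nat]
    simp only [hP]
    congr 1
    ext
    simp
  · intro k _
    simp only [hP, hsucc]
    exact hp.edge_ne _
  · intro k hk l hl hkl
    simp only [hP, hsucc]
    refine hp.simple fun h => hkl ?_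
    have := congrArg Fin.val h
    simpa [Nat.mod_eq_of_lt hk, Nat.mod_eq_of_lt hl] using this
  · rw [image_polyCurve hn, ← hp.iUnion_eq]
    ext z
    simp only [mem_iUnion, Finset.mem_range, exists_prop]
    constructor
    · rintro ⟨k, -, hz⟩
      simp only [hP, hsucc] at hz
      exact ⟨_, hz⟩
    · rintro ⟨i, hz⟩
      refine ⟨i, i.2, ?_⟩
      simp only [hP, hsucc, hcast]
      exact hz

end HypCrofton

end

theorem corollary1 (D : Set UpperHalfPlane) (hD : HypCrofton.IsCompactConvexDomain D) :
    (∀ (n : ℕ) [NeZero n] (p : Fin n → UpperHalfPlane),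
      HypCrofton.IsSimplePolygon p (frontier D) →
        HypCrofton.liouville (HypCrofton.geodesicsMeeting D) =
          ENNReal.ofReal (HypCrofton.polygonLength p / 2)) ∧
    (∀ (T : ℝ) (c : ℝ → UpperHalfPlane),
      HypCrofton.IsSimpleClosedC1Curve T c (frontier D) →
        HypCrofton.liouville (HypCrofton.geodesicsMeeting D) =
          ENNReal.ofReal (HypCrofton.curveLength T c / 2)) := by
  exact ⟨fun _ _ _ hp => hD.liouville_eq_of_polygon hp, fun _ _ hc => hD.liouville_eq_of_C1 hc⟩
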